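/- Let $\mathbb{F}$ be an algebraically closed field of characteristic zero; all Lie superalgebras are over $\mathbb{F}$, and isomorphisms are even. For a superspace $V=V_{\bar0}\oplus V_{\bar1}$ write $\mathrm{sdim}\,V=(\dim V_{\bar0},\dim V_{\bar1})$, with pairs ordered componentwise. For a finite-dimensional Lie superalgebra $L$, a defining pair of $L$ is a pair $(K,M)$ of a Lie superalgebra $K$ and a graded ideal $M$ of $K$ with $K/M\cong L$ and $M\subseteq \mathrm{Z}(K)\cap[K,K]$. The multiplier $\mathcal{M}(L)$ is the ideal $M$ of a defining pair for which $\mathrm{sdim}\,M$ is maximal among all defining pairs of $L$. If $\mathrm{sdim}\,L=(s,t)$, the super-multiplier-rank of $L$ is $$\mathrm{smr}(L)=\left(\tfrac12 s(s-1)+\tfrac12 t(t+1),\,st\right)-\mathrm{sdim}\,\mathcal{M}(L).$$ Let $\mathrm{Ab}(m,n)$ be the abelian Lie superalgebra of superdimension $(m,n)$, and for $p+q\ge 1$ let $H(p,q)$ be the Heisenberg Lie superalgebra with even basis $u_1,\dots,u_p,v_1,\dots,v_p,z$ and odd basis $w_1,\dots,w_q$, whose only nonzero brackets of basis elements are $[u_i,v_i]=-[v_i,u_i]=z$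 and $[w_k,w_k]=z$. Let $L$ be a finite-dimensional, non-abelian, nilpotent Lie superalgebra. Then: 1. $\mathrm{smr}(L)\neq(0,2)$; 2. $\mathrm{smr}(L)=(2,0)$ if and only if $L\cong H(1,0)\oplus\mathrm{Ab}(1,0)$; 3. $\mathrm{smr}(L)=(1,1)$ if and only if $L\cong H(1,0)\oplus\mathrm{Ab}(0,1)$ or $L\cong H(0,1)$. -/

import Mathlib

universe u v w

/-- A Lie superalgebra structure on the `F`-vector space `V`: a splitting `V = V₀ ⊕ V₁` and an even
bilinear bracket that is super-skew-symmetric and satisfies the super Jacobi identity.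
(This is the usual definition away from characteristics 2 and 3.) -/
structure LieSuperalgebra (F : Type u) [Field F] (V : Type v) [AddCommGroup V] [Module F V] where
  grade : ZMod 2 → Submodule F V
  isCompl : IsCompl (grade 0) (grade 1)
  bracket : V →ₗ[F] V →ₗ[F] V
  bracket_mem : ∀ {i j : ZMod 2} {x y : V}, x ∈ grade i → y ∈ grade j →
    bracket x y ∈ grade (i + j)
  skew : ∀ {i j : ZMod 2} {x y : V}, x ∈ grade i → y ∈ grade j →
    bracket x y = -((-1 : F) ^ (i.val * j.val) • bracket y x)
  jacobi : ∀ {i j : ZMod 2} {x y : V} (z : V), x ∈ grade i → y ∈ grade j →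
    bracket x (bracket y z) =
      bracket (bracket x y) z + (-1 : F) ^ (i.val * j.val) • bracket y (bracket x z)

namespace LieSuperalgebra

variable {F : Type u} [Field F]
variable {V : Type v} [AddCommGroup V] [Module F V]
variable {W : Type w} [AddCommGroup W] [Module F W]

/-- The superdimension of a (graded) subspace. -/
noncomputable def sdimSub (G : LieSuperalgebra F V) (M : Submodule F V) : ℕ × ℕ :=
  (Module.finrank F ↥(M ⊓ G.grade 0), Module.finrank F ↥(M ⊓ G.grade 1))

/-- The superdimension of the whole superalgebra. -/
noncomputable def sdim (G : LieSuperalgebra F V) : ℕ × ℕ :=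
  (Module.finrank F ↥(G.grade 0), Module.finrank F ↥(G.grade 1))

/-- The center `{x | [x, y] = 0 for all y}`. -/
def center (G : LieSuperalgebra F V) : Submodule F V := LinearMap.ker G.bracket

/-- The derived subalgebra: the span of all brackets. -/
def derived (G : LieSuperalgebra F V) : Submodule F V := Submodule.map₂ G.bracket ⊤ ⊤

def IsAbelian (G : LieSuperalgebra F V) : Prop := ∀ x y : V, G.bracket x y = 0

/-- The lower central series, starting with the whole algebra at index `0`. -/
def lcs (G : LieSuperalgebra F V) : ℕ → Submodule F V
  | 0 => ⊤
  | n + 1 => Submodule.map₂ G.bracket ⊤ (lcs G n)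

def IsNilpotent (G : LieSuperalgebra F V) : Prop := ∃ n : ℕ, G.lcs n = ⊥

/-- (Even) homomorphisms of Lie superalgebras. -/
structure Hom (G : LieSuperalgebra F V) (H : LieSuperalgebra F W) where
  toLinearMap : V →ₗ[F] W
  map_grade : ∀ {i : ZMod 2} {x : V}, x ∈ G.grade i → toLinearMap x ∈ H.grade i
  map_bracket : ∀ x y : V,
    toLinearMap (G.bracket x y) = H.bracket (toLinearMap x) (toLinearMap y)

/-- Isomorphism of Lie superalgebras: a bijective even homomorphism exists. -/
def Isomorphic (G : LieSuperalgebra F V) (H : LieSuperalgebra F W) : Prop :=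
  ∃ f : Hom G H, Function.Bijective f.toLinearMap

/-- `(H, M)` is a defining pair of `G`: `M` is the kernel of a surjective homomorphism `H → G`
(that is, `M` is a graded ideal and `H / M ≅ G`), and `M` lies in the center and in the derived
subalgebra of `H`. -/
structure IsDefiningPair (G : LieSuperalgebra F V) (H : LieSuperalgebra F W)
    (M : Submodule F W) : Prop where
  exists_hom : ∃ f : Hom H G, Function.Surjective f.toLinearMap ∧ LinearMap.ker f.toLinearMap = M
  le_center : M ≤ H.center
  le_derived : M ≤ H.derived

/-- The superdimensions of the second members of the defining pairs of `G`. -/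
def definingSdims (G : LieSuperalgebra F V) : Set (ℕ × ℕ) :=
  {d | ∃ (K : Type v) (_ : AddCommGroup K) (_ : Module F K) (H : LieSuperalgebra F K)
    (M : Submodule F K), IsDefiningPair G H M ∧ H.sdimSub M = d}

theorem zero_mem_definingSdims (G : LieSuperalgebra F V) : (0, 0) ∈ G.definingSdims := by
  refine ⟨V, inferInstance, inferInstance, G, ⊥,
    ⟨⟨⟨LinearMap.id, fun h => h, fun _ _ => rfl⟩, Function.surjective_id, ?_⟩,
      bot_le, bot_le⟩, ?_⟩
  · exact LinearMap.ker_id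
  · simp [sdimSub]

theorem IsDefiningPair.finrank_bound [FiniteDimensional F V] {G : LieSuperalgebra F V}
    {H : LieSuperalgebra F W} {M : Submodule F W} (h : IsDefiningPair G H M) :
    H.sdimSub M ≤ (Module.finrank F V * Module.finrank F V,
      Module.finrank F V * Module.finrank F V) := by
  obtain ⟨f, hf, hk⟩ := h.exists_hom
  obtain ⟨σ, hσ⟩ := f.toLinearMap.exists_rightInverse_of_surjective
    (LinearMap.range_eq_top.mpr hf)
  have hσ' : ∀ x, f.toLinearMap (σ x) = x := fun x => LinearMap.congr_fun hσ x
  have hM : ∀ x : W, x - σ (f.toLinearMap x) ∈ M := by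
    intro x
    rw [← hk, LinearMap.mem_ker, map_sub, hσ', sub_self]
  have hl : ∀ m ∈ M, ∀ y, H.bracket m y = 0 := fun m hm y => by
    have : H.bracket m = 0 := h.le_center hm
    rw [this]; rfl
  have hgrade : ∀ y : W, ∃ a ∈ H.grade 0, ∃ b ∈ H.grade 1, a + b = y := fun y => by
    have : y ∈ H.grade 0 ⊔ H.grade 1 := by rw [H.isCompl.sup_eq_top]; trivial
    exact Submodule.mem_sup.mp this
  -- graded components of elements of `M` lie in `M`, hence `M` annihilates from the right as well
  have hcomp : ∀ a ∈ H.grade 0, ∀ b ∈ H.grade 1, a + b ∈ M → a ∈ M ∧ b ∈ M := by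
    intro a ha b hb hab
    rw [← hk, LinearMap.mem_ker, map_add] at hab
    have h0 : f.toLinearMap a = 0 := by
      have h1 : f.toLinearMap a ∈ G.grade 1 := by
        rw [eq_neg_of_add_eq_zero_left hab]
        exact (G.grade 1).neg_mem (f.map_grade hb)
      exact Submodule.disjoint_def.mp G.isCompl.disjoint _ (f.map_grade ha) h1
    rw [← hk, LinearMap.mem_ker, LinearMap.mem_ker]
    exact ⟨h0, by simpa [h0] using hab⟩
  have hhom : ∀ (i : ZMod 2) (m : W), m ∈ H.grade i → m ∈ M → ∀ y, H.bracket y m = 0 := by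
    intro i m hi hm y
    obtain ⟨a, ha, b, hb, rfl⟩ := hgrade y
    rw [map_add, LinearMap.add_apply, H.skew ha hi, H.skew hb hi, hl m hm, hl m hm]
    simp
  have hr : ∀ m ∈ M, ∀ y, H.bracket y m = 0 := by
    intro m hm y
    obtain ⟨a, ha, b, hb, rfl⟩ := hgrade m
    obtain ⟨h1, h2⟩ := hcomp a ha b hb hm
    rw [map_add, hhom 0 a ha h1, hhom 1 b hb h2, add_zero]
  let B : TensorProduct F V V →ₗ[F] W := TensorProduct.lift (H.bracket.compl₁₂ σ σ)
  have hder : H.derived ≤ LinearMap.range B := by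
    refine Submodule.map₂_le.mpr fun x _ y _ => ⟨f.toLinearMap x ⊗ₜ f.toLinearMap y, ?_⟩
    have e1 := hl _ (hM x) y
    have e2 := hr _ (hM y) (σ (f.toLinearMap x))
    rw [map_sub, LinearMap.sub_apply, sub_eq_zero] at e1
    rw [map_sub, sub_eq_zero] at e2
    simp only [B, TensorProduct.lift.tmul, LinearMap.compl₁₂_apply]
    rw [e1, e2]
  have key : ∀ N : Submodule F W, N ≤ M →
      Module.finrank F ↥N ≤ Module.finrank F V * Module.finrank F V := by
    intro N hN
    calc Module.finrank F ↥N ≤ Module.finrank F ↥(LinearMap.range B) :=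
          Submodule.finrank_mono (hN.trans (h.le_derived.trans hder))
      _ ≤ Module.finrank F (TensorProduct F V V) := LinearMap.finrank_range_le B
      _ = _ := Module.finrank_tensorProduct
  exact ⟨key _ inf_le_left, key _ inf_le_left⟩

theorem exists_maximal_definingSdims [FiniteDimensional F V] (G : LieSuperalgebra F V) :
    ∃ d, Maximal (· ∈ G.definingSdims) d := by
  have hfin : G.definingSdims.Finite := by
    refine (Set.finite_Iic (Module.finrank F V * Module.finrank F V,
      Module.finrank F V * Module.finrank F V)).subset ?_
    rintro d ⟨K, _, _, H, M, h, rfl⟩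
    exact h.finrank_bound
  exact hfin.exists_maximal ⟨_, G.zero_mem_definingSdims⟩

/-- The superdimension of the multiplier of `G`: the superdimension of `M` for a maximal
defining pair `(K, M)` of `G`. -/
noncomputable def sdimMultiplier [FiniteDimensional F V] (G : LieSuperalgebra F V) : ℕ × ℕ :=
  G.exists_maximal_definingSdims.choose

/-- The super-multiplier-rank `(s(s-1)/2 + t(t+1)/2, st) - sdim M(G)` where `sdim G = (s, t)`.
Both integer divisions are exact. -/
noncomputable def smr [FiniteDimensional F V] (G : LieSuperalgebra F V) : ℤ × ℤ :=
  let s : ℤ := G.sdim.1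
  let t : ℤ := G.sdim.2
  (s * (s - 1) / 2 + t * (t + 1) / 2, s * t) - ((G.sdimMultiplier.1 : ℤ), (G.sdimMultiplier.2 : ℤ))

/-- The grading of `V × W` with even part `V` and odd part `W`. -/
def prodGrade (F : Type u) [Field F] (V : Type v) [AddCommGroup V] [Module F V]
    (W : Type w) [AddCommGroup W] [Module F W] (i : ZMod 2) : Submodule F (V × W) :=
  if i = 0 then Submodule.prod ⊤ ⊥ else Submodule.prod ⊥ ⊤

theorem mem_prodGrade_zero {x : V × W} : x ∈ prodGrade F V W 0 ↔ x.2 = 0 := by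
  simp [prodGrade, Submodule.mem_prod]

theorem mem_prodGrade_one {x : V × W} : x ∈ prodGrade F V W 1 ↔ x.1 = 0 := by
  simp [prodGrade, Submodule.mem_prod]

theorem isCompl_prodGrade : IsCompl (prodGrade F V W 0) (prodGrade F V W 1) := by
  constructor
  · rw [Submodule.disjoint_def]
    intro x h0 h1
    exact Prod.ext (mem_prodGrade_one.mp h1) (mem_prodGrade_zero.mp h0)
  · rw [codisjoint_iff, eq_top_iff]
    intro x _
    exact Submodule.mem_sup.mpr ⟨(x.1, 0), mem_prodGrade_zero.mpr rfl, (0, x.2),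
      mem_prodGrade_one.mpr rfl, by simp⟩

/-- The abelian Lie superalgebra `Ab(m, n)` of superdimension `(m, n)`. -/
def ab (F : Type u) [Field F] (m n : ℕ) : LieSuperalgebra F ((Fin m → F) × (Fin n → F)) where
  grade := prodGrade F _ _
  isCompl := isCompl_prodGrade
  bracket := 0
  bracket_mem _ _ := Submodule.zero_mem _
  skew _ _ := by simp
  jacobi _ _ _ := by simp

/-- The bracket of the Heisenberg superalgebra with even center. In coordinates
`((u, v, z), w)` it is given by `[uᵢ, vᵢ] = z = -[vᵢ, uᵢ]` and `[wₖ, wₖ] = z`. -/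
def heisenbergBracket (F : Type u) [Field F] (p q : ℕ) :
    (((Fin p → F) × (Fin p → F) × F) × (Fin q → F)) →ₗ[F]
    (((Fin p → F) × (Fin p → F) × F) × (Fin q → F)) →ₗ[F]
    (((Fin p → F) × (Fin p → F) × F) × (Fin q → F)) :=
  LinearMap.mk₂ F
    (fun x y => ((0, 0, ∑ i, (x.1.1 i * y.1.2.1 i - x.1.2.1 i * y.1.1 i) + ∑ k, x.2 k * y.2 k), 0))
    (by
      intro x x' y
      simp only [Prod.fst_add, Prod.snd_add, Pi.add_apply, Prod.mk_add_mk, add_zero, Prod.mk.injEq,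
        true_and, and_true, add_mul, Finset.sum_add_distrib, Finset.sum_sub_distrib]
      ring)
    (by
      intro c x y
      simp only [Prod.smul_fst, Prod.smul_snd, Pi.smul_apply, Prod.smul_mk, smul_zero,
        smul_eq_mul, mul_add, Finset.mul_sum, mul_sub,
        mul_assoc])
    (by
      intro x y y'
      simp only [Prod.fst_add, Prod.snd_add, Pi.add_apply, Prod.mk_add_mk, add_zero, Prod.mk.injEq,
        true_and, and_true, mul_add, Finset.sum_add_distrib, Finset.sum_sub_distrib]
      ring)
    (by
      intro c x y
      simp only [Prod.smul_fst, Prod.smul_snd, Pi.smul_apply, Prod.smul_mk, smul_zero,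
        smul_eq_mul, mul_add, Finset.mul_sum, mul_sub,
        mul_left_comm])

theorem heisenbergBracket_apply (F : Type u) [Field F] (p q : ℕ)
    (x y : ((Fin p → F) × (Fin p → F) × F) × (Fin q → F)) :
    heisenbergBracket F p q x y =
      ((0, 0, ∑ i, (x.1.1 i * y.1.2.1 i - x.1.2.1 i * y.1.1 i) + ∑ k, x.2 k * y.2 k), 0) := rfl

/-- The Heisenberg Lie superalgebra `H(p, q)` with even center, of superdimension
`(2p + 1, q)`. -/
def heisenberg (F : Type u) [Field F] (p q : ℕ) :
    LieSuperalgebra F (((Fin p → F) × (Fin p → F) × F) × (Fin q → F)) where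
  grade := prodGrade F _ _
  isCompl := isCompl_prodGrade
  bracket := heisenbergBracket F p q
  bracket_mem {i j x y} hx hy := by
    fin_cases i <;> fin_cases j <;>
      simp only [Fin.zero_eta, Fin.mk_one, Fin.isValue] at hx hy ⊢
    · exact mem_prodGrade_zero.mpr rfl
    · have hx' := mem_prodGrade_zero.mp hx
      have hy' := mem_prodGrade_one.mp hy
      have : heisenbergBracket F p q x y = 0 := by
        simp [heisenbergBracket_apply, hx', hy']
      rw [this]; exact Submodule.zero_mem _
    · have hx' := mem_prodGrade_one.mp hx
      have hy' := mem_prodGrade_zero.mp hy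
      have : heisenbergBracket F p q x y = 0 := by
        simp [heisenbergBracket_apply, hx', hy']
      rw [this]; exact Submodule.zero_mem _
    · exact mem_prodGrade_zero.mpr rfl
  skew {i j x y} hx hy := by
    fin_cases i <;> fin_cases j <;>
      simp only [Fin.zero_eta, Fin.mk_one, Fin.isValue] at hx hy ⊢
    · have hx' := mem_prodGrade_zero.mp hx
      have hy' := mem_prodGrade_zero.mp hy
      have h0 : (-1 : F) ^ ((0 : ZMod 2).val * (0 : ZMod 2).val) = 1 := pow_zero _
      erw [h0]
      simp [heisenbergBracket_apply, hx', hy', mul_comm]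
    · have hx' := mem_prodGrade_zero.mp hx
      have hy' := mem_prodGrade_one.mp hy
      simp [heisenbergBracket_apply, hx', hy']
    · have hx' := mem_prodGrade_one.mp hx
      have hy' := mem_prodGrade_zero.mp hy
      simp [heisenbergBracket_apply, hx', hy']
    · have hx' := mem_prodGrade_one.mp hx
      have hy' := mem_prodGrade_one.mp hy
      have h1 : (-1 : F) ^ ((1 : ZMod 2).val * (1 : ZMod 2).val) = -1 := pow_one _
      erw [h1]
      simp [heisenbergBracket_apply, hx', hy', mul_comm]
  jacobi z _ _ := by simp [heisenbergBracket_apply]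

/-- The direct sum of two Lie superalgebras. -/
def directSum (G : LieSuperalgebra F V) (H : LieSuperalgebra F W) :
    LieSuperalgebra F (V × W) where
  grade i := (G.grade i).prod (H.grade i)
  isCompl := by
    constructor
    · rw [Submodule.disjoint_def]
      intro x h0 h1
      exact Prod.ext (Submodule.disjoint_def.mp G.isCompl.disjoint _ h0.1 h1.1)
        (Submodule.disjoint_def.mp H.isCompl.disjoint _ h0.2 h1.2)
    · rw [codisjoint_iff, Submodule.prod_sup_prod, G.isCompl.sup_eq_top, H.isCompl.sup_eq_top,
        Submodule.prod_top]
  bracket := LinearMap.mk₂ F (fun x y => (G.bracket x.1 y.1, H.bracket x.2 y.2))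
    (by intros; simp) (by intros; simp) (by intros; simp) (by intros; simp)
  bracket_mem hx hy := ⟨G.bracket_mem hx.1 hy.1, H.bracket_mem hx.2 hy.2⟩
  skew hx hy := Prod.ext (G.skew hx.1 hy.1) (H.skew hx.2 hy.2)
  jacobi z hx hy := Prod.ext (G.jacobi z.1 hx.1 hy.1) (H.jacobi z.2 hx.2 hy.2)

end LieSuperalgebra

set_option maxSynthPendingDepth 3

namespace LieSuperalgebra

variable {F : Type u} [Field F]
variable {V : Type v} [AddCommGroup V] [Module F V]
variable {W : Type w} [AddCommGroup W] [Module F W]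

/-! Let `C` be the super-skew bilinear forms on `L`, `Z ⊆ C` the 2-cocycles with trivial
coefficients, and `L'` the derived subalgebra. The multiplier is dual to the second cohomology, the
coboundaries form a copy of the dual of `L'`, and `sdim C` is the pair from which `smr` subtracts.
Hence `smr L = sdim L' + sdim C - sdim Z` (`smr_eq`): both `L'` and the forms that fail to be
cocycles push the rank up, and a small rank leaves room for little of either.

Failures come from one observation (`cocycle_center_derived`): a cocycle pairs a homogeneous central
vector trivially with `L'`. A nilpotent non-abelian `L` has a nonzero homogeneous central commutator
`c`. If `c` is even it contributes to `L'`; if `c` is odd, the square of a functional dual to `c` is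
an even form that is not a cocycle. Either way the even part of the rank is positive, which excludes
`(0,2)`. Counting more such forms shows that for rank `(2,0)` or `(1,1)` the derived subalgebra is
an even central line `F c` (`exists_derived_eq_span`).

When `L' = F c`, the rank is the superdimension of a graded subspace `P` containing `c`, provided
that a skew form is a cocycle exactly when it pairs `c` trivially with `P` (`smr_eq_sdimSub`). If
some odd `w` has `[w,w] ≠ 0`, then `P = L`, so rank `(2,0)` is impossible and rank `(1,1)` means
`H(0,1)`. Otherwise the bracket lives on the even part. Choosing even `u, v` with `[u,v] = c`, every
cocycle pairs `c` trivially with the vectors commuting with `u` and `v`. If that space has even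
dimension at most two, its bracket vanishes, since `c` and two non-commuting even vectors would be
independent. So `L` is `H(1,0)` plus an abelian summand, `P` is exactly this space, and `sdim P =
(m+1, n)` for the summand `Ab(m,n)`. -/

/-! ### Homogeneous components, derived subalgebra and center -/

theorem zmod_two_cases (i : ZMod 2) : i = 0 ∨ i = 1 := by
  revert i; decide

theorem zmod_two_eq_add_one {i j : ZMod 2} (h : j ≠ i) : j = i + 1 := by
  revert i j; decide

theorem isCompl_grade (L : LieSuperalgebra F V) (i : ZMod 2) :
    IsCompl (L.grade i) (L.grade (i + 1)) := by
  rcases zmod_two_cases i with rfl | rfl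
  · exact L.isCompl
  · exact L.isCompl.symm

/-- The projection onto the component of parity `i`. -/
noncomputable def proj (L : LieSuperalgebra F V) (i : ZMod 2) : V →ₗ[F] V :=
  (L.grade i).projection (L.grade (i + 1)) (L.isCompl_grade i)

theorem proj_mem (L : LieSuperalgebra F V) (i : ZMod 2) (x : V) : L.proj i x ∈ L.grade i :=
  Submodule.projection_apply_mem _ _

theorem proj_of_mem (L : LieSuperalgebra F V) {i : ZMod 2} {x : V} (hx : x ∈ L.grade i) :
    L.proj i x = x :=
  Submodule.projection_apply_of_mem_left _ hx

theorem proj_of_mem_of_ne (L : LieSuperalgebra F V) {i j : ZMod 2} {x : V} (hx : x ∈ L.grade j)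
    (h : j ≠ i) : L.proj i x = 0 := by
  obtain rfl := zmod_two_eq_add_one h
  exact Submodule.projection_apply_of_mem_right _ hx

theorem proj_add_proj (L : LieSuperalgebra F V) (x : V) : L.proj 0 x + L.proj 1 x = x :=
  Submodule.projection_add_projection_eq_self L.isCompl x

theorem eq_zero_of_mem_grade (L : LieSuperalgebra F V) {i j : ZMod 2} (h : j ≠ i) {x : V}
    (hi : x ∈ L.grade i) (hj : x ∈ L.grade j) : x = 0 := by
  rw [← L.proj_of_mem hi, L.proj_of_mem_of_ne hj h]

/-- A property of vectors that is stable under addition holds everywhere as soon as it holds for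
homogeneous vectors. -/
theorem homogeneous_induction (L : LieSuperalgebra F V) {p : V → Prop}
    (hom : ∀ i x, x ∈ L.grade i → p x) (add : ∀ x y, p x → p y → p (x + y)) (x : V) : p x := by
  rw [← L.proj_add_proj x]
  exact add _ _ (hom 0 _ (L.proj_mem 0 x)) (hom 1 _ (L.proj_mem 1 x))

theorem linearMap_ext (L : LieSuperalgebra F V) {f g : V →ₗ[F] W}
    (h : ∀ i x, x ∈ L.grade i → f x = g x) : f = g := by
  ext x
  induction x using L.homogeneous_induction with
  | hom i x hx => exact h i x hx
  | add x y hx hy => rw [map_add, map_add, hx, hy]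

theorem bilinear_ext (L : LieSuperalgebra F V) {f g : V →ₗ[F] V →ₗ[F] W}
    (h : ∀ i j x y, x ∈ L.grade i → y ∈ L.grade j → f x y = g x y) : f = g :=
  L.linearMap_ext fun i x hx => L.linearMap_ext fun j y hy => h i j x y hx hy

/-- A functional is homogeneous of parity `i` if it vanishes on vectors of the other parity. -/
def IsHomFunctional (L : LieSuperalgebra F V) (i : ZMod 2) (f : V →ₗ[F] W) : Prop :=
  ∀ j x, x ∈ L.grade j → j ≠ i → f x = 0

theorem isHomFunctional_comp_proj (L : LieSuperalgebra F V) (i : ZMod 2) (f : V →ₗ[F] W) :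
    L.IsHomFunctional i (f ∘ₗ L.proj i) := by
  intro j x hx hj
  rw [LinearMap.comp_apply, L.proj_of_mem_of_ne hx hj, map_zero]

theorem IsHomFunctional.comp {L : LieSuperalgebra F V} {i : ZMod 2} {f : V →ₗ[F] W}
    (hf : L.IsHomFunctional i f) {U : Type*} [AddCommGroup U] [Module F U] (g : W →ₗ[F] U) :
    L.IsHomFunctional i (g ∘ₗ f) := by
  intro j x hx hj
  rw [LinearMap.comp_apply, hf j x hx hj, map_zero]

/-- A homogeneous subspace admits a retraction that vanishes on the other parity. -/
theorem exists_retraction (L : LieSuperalgebra F V) {i : ZMod 2} {U : Submodule F V}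
    (hU : U ≤ L.grade i) :
    ∃ r : V →ₗ[F] U, (∀ x : U, r x = x) ∧ L.IsHomFunctional i r := by
  obtain ⟨r, hr⟩ := U.subtype.exists_leftInverse_of_injective U.ker_subtype
  refine ⟨r ∘ₗ L.proj i, fun x => ?_, L.isHomFunctional_comp_proj i r⟩
  rw [LinearMap.comp_apply, L.proj_of_mem (hU x.2)]
  exact LinearMap.congr_fun hr x

theorem bracket_mem_derived (L : LieSuperalgebra F V) (x y : V) : L.bracket x y ∈ L.derived :=
  Submodule.apply_mem_map₂ _ trivial trivial

theorem derived_le (L : LieSuperalgebra F V) {U : Submodule F V}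
    (h : ∀ i j x y, x ∈ L.grade i → y ∈ L.grade j → L.bracket x y ∈ U) : L.derived ≤ U := by
  refine Submodule.map₂_le.mpr fun x hx y hy => ?_
  clear hx hy
  induction x using L.homogeneous_induction with
  | hom i x hx =>
    induction y using L.homogeneous_induction with
    | hom j y hy => exact h i j x y hx hy
    | add y y' hy hy' => rw [map_add]; exact U.add_mem hy hy'
  | add x x' hx hx' => rw [map_add, LinearMap.add_apply]; exact U.add_mem hx hx'

theorem proj_mem_derived (L : LieSuperalgebra F V) (i : ZMod 2) {x : V} (hx : x ∈ L.derived) :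
    L.proj i x ∈ L.derived := by
  suffices L.derived ≤ L.derived.comap (L.proj i) from this hx
  refine L.derived_le fun j k x y hx hy => ?_
  rw [Submodule.mem_comap]
  have hxy := L.bracket_mem hx hy
  by_cases h : j + k = i
  · subst h
    rw [L.proj_of_mem hxy]
    exact L.bracket_mem_derived x y
  · rw [L.proj_of_mem_of_ne hxy h]
    exact zero_mem _

theorem bracket_eq_zero_comm (L : LieSuperalgebra F V) {i j : ZMod 2} {x y : V}
    (hx : x ∈ L.grade i) (hy : y ∈ L.grade j) (h : L.bracket x y = 0) : L.bracket y x = 0 := by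
  rw [L.skew hy hx, h, smul_zero, neg_zero]

theorem bracket_eq_zero_of_mem_center (L : LieSuperalgebra F V) {x : V} (hx : x ∈ L.center)
    (y : V) : L.bracket x y = 0 := by
  rw [LinearMap.mem_ker.mp hx, LinearMap.zero_apply]

/-- A homogeneous vector annihilated by all homogeneous vectors is central. -/
theorem mem_center_of_homogeneous (L : LieSuperalgebra F V) {i : ZMod 2} {x : V}
    (hx : x ∈ L.grade i) (h : ∀ j y, y ∈ L.grade j → L.bracket y x = 0) : x ∈ L.center :=
  LinearMap.mem_ker.mpr <| L.linearMap_ext fun j y hy =>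
    L.bracket_eq_zero_comm hy hx (h j y hy)

/-- For homogeneous `y`, the brackets of the two components of `x` with `y` lie in different
parities, so they vanish separately when their sum does. -/
theorem proj_mem_center (L : LieSuperalgebra F V) (i : ZMod 2) {x : V} (hx : x ∈ L.center) :
    L.proj i x ∈ L.center := by
  refine LinearMap.mem_ker.mpr <| L.linearMap_ext fun j y hy => ?_
  have hsum : L.bracket (L.proj 0 x) y + L.bracket (L.proj 1 x) y = 0 := by
    rw [← LinearMap.add_apply, ← map_add, L.proj_add_proj, L.bracket_eq_zero_of_mem_center hx]
  have h0 := L.bracket_mem (L.proj_mem 0 x) hy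
  have h1 := L.bracket_mem (L.proj_mem 1 x) hy
  have e := congrArg (L.proj (i + j)) hsum
  rw [map_add, map_zero] at e
  rcases zmod_two_cases i with rfl | rfl
  · rwa [L.proj_of_mem h0, L.proj_of_mem_of_ne h1 (by simp), add_zero] at e
  · rwa [L.proj_of_mem h1, L.proj_of_mem_of_ne h0 (by simp), zero_add] at e

/-- The center is defined as a left annihilator. Skew-symmetry is available only for homogeneous
vectors, so passing to the right annihilator goes through components. -/
theorem bracket_center (L : LieSuperalgebra F V) {x : V} (hx : x ∈ L.center) (y : V) :
    L.bracket y x = 0 := by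
  have key : ∀ i, L.bracket y (L.proj i x) = 0 := fun i => by
    induction y using L.homogeneous_induction with
    | hom j y hy =>
      exact L.bracket_eq_zero_comm (L.proj_mem i x) hy
        (L.bracket_eq_zero_of_mem_center (L.proj_mem_center i hx) y)
    | add y y' hy hy' => rw [map_add, LinearMap.add_apply, hy, hy', add_zero]
  rw [← L.proj_add_proj x, map_add, key, key, add_zero]

/-- A nilpotent non-abelian Lie superalgebra has a nonzero homogeneous central commutator. -/
theorem exists_central_derived (L : LieSuperalgebra F V) (hnil : L.IsNilpotent)
    (hab : ¬ L.IsAbelian) :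
    ∃ (i : ZMod 2) (c : V), c ∈ L.grade i ∧ c ≠ 0 ∧ c ∈ L.center ∧ c ∈ L.derived := by
  classical
  have hn := Nat.find_spec hnil
  -- Non-abelian means that the series survives past index 1, so its last nonzero term has index at
  -- least 1 and lies in the derived subalgebra.
  obtain ⟨n, hm⟩ : ∃ n, Nat.find hnil = n + 2 := by
    refine Nat.exists_eq_add_of_le' ?_
    by_contra! hlt
    apply hab
    have h1 : L.lcs 1 = ⊥ := by
      interval_cases h : Nat.find hnil
      · have h0 : (⊤ : Submodule F V) = ⊥ := hn
        have : ∀ x : V, x = 0 := fun x => by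
          have : x ∈ (⊤ : Submodule F V) := trivial
          rwa [h0, Submodule.mem_bot] at this
        exact (Submodule.eq_bot_iff _).mpr fun x _ => this x
      · exact hn
    intro x y
    have : L.bracket x y ∈ L.lcs 1 := Submodule.apply_mem_map₂ _ trivial trivial
    rwa [h1, Submodule.mem_bot] at this
  have hne : L.lcs (n + 1) ≠ ⊥ := Nat.find_min hnil (by omega)
  rw [hm] at hn
  obtain ⟨x, hx, hx0⟩ := Submodule.exists_mem_ne_zero_of_ne_bot hne
  have hann : ∀ y, L.bracket y x = 0 := fun y => by
    have : L.bracket y x ∈ L.lcs (n + 2) := Submodule.apply_mem_map₂ _ trivial hx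
    rwa [hn, Submodule.mem_bot] at this
  have hder : x ∈ L.derived := Submodule.map₂_le_map₂_right le_top hx
  have hproj : ∀ i, L.proj i x ∈ L.center := by
    intro i
    refine L.mem_center_of_homogeneous (L.proj_mem i x) fun j y hy => ?_
    have hsum : L.bracket y (L.proj 0 x) + L.bracket y (L.proj 1 x) = 0 := by
      rw [← map_add, L.proj_add_proj, hann]
    have h0 := L.bracket_mem hy (L.proj_mem 0 x)
    have h1 := L.bracket_mem hy (L.proj_mem 1 x)
    have e := congrArg (L.proj (j + i)) hsum
    rw [map_add, map_zero] at e
    rcases zmod_two_cases i with rfl | rfl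
    · rwa [L.proj_of_mem h0, L.proj_of_mem_of_ne h1 (by simp), add_zero] at e
    · rwa [L.proj_of_mem h1, L.proj_of_mem_of_ne h0 (by simp), zero_add] at e
  by_cases h : L.proj 0 x = 0
  · refine ⟨1, L.proj 1 x, L.proj_mem 1 x, fun h1 => hx0 ?_, hproj 1, L.proj_mem_derived 1 hder⟩
    rw [← L.proj_add_proj x, h, h1, add_zero]
  · exact ⟨0, L.proj 0 x, L.proj_mem 0 x, h, hproj 0, L.proj_mem_derived 0 hder⟩

/-! ### Skew forms and 2-cocycles -/

/-- The super-skew-symmetric bilinear forms of parity `i`. -/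
def skewForms (L : LieSuperalgebra F V) (i : ZMod 2) : Submodule F (V →ₗ[F] V →ₗ[F] F) where
  carrier := {ω | ∀ a b x y, x ∈ L.grade a → y ∈ L.grade b →
    ω x y = -((-1 : F) ^ (a.val * b.val) * ω y x) ∧ (a + b ≠ i → ω x y = 0)}
  zero_mem' := by intro a b x y _ _; simp
  add_mem' := by
    intro ω η hω hη a b x y hx hy
    obtain ⟨h1, h2⟩ := hω a b x y hx hy
    obtain ⟨h3, h4⟩ := hη a b x y hx hy
    refine ⟨?_, fun h => ?_⟩
    · simp only [LinearMap.add_apply]; rw [h1, h3]; ring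
    · simp only [LinearMap.add_apply]; rw [h2 h, h4 h, add_zero]
  smul_mem' := by
    intro r ω hω a b x y hx hy
    obtain ⟨h1, h2⟩ := hω a b x y hx hy
    refine ⟨?_, fun h => ?_⟩
    · simp only [LinearMap.smul_apply, smul_eq_mul]; rw [h1]; ring
    · simp only [LinearMap.smul_apply, smul_eq_mul]; rw [h2 h, mul_zero]

/-- The 2-cocycles of parity `i` with trivial coefficients. -/
def cocycles (L : LieSuperalgebra F V) (i : ZMod 2) : Submodule F (V →ₗ[F] V →ₗ[F] F) where
  carrier := {ω | ω ∈ L.skewForms i ∧ ∀ a b x y z, x ∈ L.grade a → y ∈ L.grade b →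
    ω x (L.bracket y z) = ω (L.bracket x y) z + (-1 : F) ^ (a.val * b.val) * ω y (L.bracket x z)}
  zero_mem' := ⟨zero_mem _, by intro a b x y z _ _; simp⟩
  add_mem' := by
    rintro ω η ⟨hω, hω'⟩ ⟨hη, hη'⟩
    refine ⟨add_mem hω hη, fun a b x y z hx hy => ?_⟩
    simp only [LinearMap.add_apply]
    rw [hω' a b x y z hx hy, hη' a b x y z hx hy]; ring
  smul_mem' := by
    rintro r ω ⟨hω, hω'⟩
    refine ⟨Submodule.smul_mem _ r hω, fun a b x y z hx hy => ?_⟩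
    simp only [LinearMap.smul_apply, smul_eq_mul]
    rw [hω' a b x y z hx hy]; ring

theorem cocycles_le_skewForms (L : LieSuperalgebra F V) (i : ZMod 2) :
    L.cocycles i ≤ L.skewForms i := fun _ h => h.1

/-- Composing the bracket with a homogeneous functional gives a cocycle (a coboundary). -/
theorem comp_bracket_mem_cocycles (L : LieSuperalgebra F V) {i : ZMod 2} {f : V →ₗ[F] F}
    (hf : L.IsHomFunctional i f) : L.bracket.compr₂ f ∈ L.cocycles i := by
  refine ⟨fun a b x y hx hy => ⟨?_, fun h => ?_⟩, fun a b x y z hx hy => ?_⟩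
  · simp only [LinearMap.compr₂_apply]
    rw [L.skew hx hy, map_neg, map_smul, smul_eq_mul]
  · exact hf _ _ (L.bracket_mem hx hy) h
  · simp only [LinearMap.compr₂_apply]
    rw [L.jacobi z hx hy, map_add, map_smul, smul_eq_mul]

/-! ### Upper bound: defining pairs embed into cocycles -/

theorem Hom.map_proj {G : LieSuperalgebra F V} {H : LieSuperalgebra F W} (f : Hom G H)
    (i : ZMod 2) (x : V) : f.toLinearMap (G.proj i x) = H.proj i (f.toLinearMap x) := by
  induction x using G.homogeneous_induction with
  | hom j x hx =>
    by_cases h : j = i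
    · subst h
      rw [G.proj_of_mem hx, H.proj_of_mem (f.map_grade hx)]
    · rw [G.proj_of_mem_of_ne hx h, H.proj_of_mem_of_ne (f.map_grade hx) h, map_zero]
  | add x y hx hy => simp only [map_add, hx, hy]

/-- A surjective homomorphism has an even linear section. -/
theorem Hom.exists_section {G : LieSuperalgebra F V} {H : LieSuperalgebra F W} (f : Hom G H)
    (hf : Function.Surjective f.toLinearMap) :
    ∃ σ : W →ₗ[F] V, (∀ y, f.toLinearMap (σ y) = y) ∧
      ∀ i y, y ∈ H.grade i → σ y ∈ G.grade i := by
  obtain ⟨σ, hσ⟩ := f.toLinearMap.exists_rightInverse_of_surjective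
    (LinearMap.range_eq_top.mpr hf)
  have hσ' : ∀ x, f.toLinearMap (σ x) = x := fun x => LinearMap.congr_fun hσ x
  -- Dropping the parity-changing blocks of an arbitrary section keeps it a section, because the
  -- homomorphism is even.
  refine ⟨G.proj 0 ∘ₗ σ ∘ₗ H.proj 0 + G.proj 1 ∘ₗ σ ∘ₗ H.proj 1, fun y => ?_, fun i y hy => ?_⟩
  · simp only [LinearMap.add_apply, LinearMap.comp_apply, map_add, f.map_proj, hσ']
    rw [H.proj_of_mem (H.proj_mem 0 y), H.proj_of_mem (H.proj_mem 1 y), H.proj_add_proj]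
  · simp only [LinearMap.add_apply, LinearMap.comp_apply]
    rcases zmod_two_cases i with rfl | rfl
    · rw [H.proj_of_mem_of_ne (i := 1) hy (by decide), map_zero, map_zero, add_zero]
      exact G.proj_mem _ _
    · rw [H.proj_of_mem_of_ne (i := 0) hy (by decide), map_zero, map_zero, zero_add]
      exact G.proj_mem _ _

/-- Postcomposition of a fixed bilinear map with functionals. -/
def comprDual (B : V →ₗ[F] V →ₗ[F] W) : (W →ₗ[F] F) →ₗ[F] (V →ₗ[F] V →ₗ[F] F) where
  toFun ψ := B.compr₂ ψ
  map_add' _ _ := rfl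
  map_smul' _ _ := rfl

@[simp]
theorem comprDual_apply (B : V →ₗ[F] V →ₗ[F] W) (ψ : W →ₗ[F] F) (x y : V) :
    comprDual B ψ x y = ψ (B x y) := rfl

/-- Pulling back a functional on a central extension along an even section gives a cocycle. -/
theorem section_mem_cocycles {G : LieSuperalgebra F V} {H : LieSuperalgebra F W} {f : Hom H G}
    (hc : LinearMap.ker f.toLinearMap ≤ H.center) {σ : V →ₗ[F] W}
    (hσ : ∀ y, f.toLinearMap (σ y) = y) (hσg : ∀ i y, y ∈ G.grade i → σ y ∈ H.grade i)
    {i : ZMod 2} {φ : W →ₗ[F] F} (hφ : H.IsHomFunctional i φ) :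
    (H.bracket.compl₁₂ σ σ).compr₂ φ ∈ G.cocycles i := by
  -- The section is not multiplicative, but its defect lies in the central kernel and so is
  -- invisible inside a further bracket.
  have hl : ∀ x y z, H.bracket (σ (G.bracket x y)) z = H.bracket (H.bracket (σ x) (σ y)) z := by
    intro x y z
    rw [← sub_eq_zero, ← LinearMap.sub_apply, ← map_sub]
    refine H.bracket_eq_zero_of_mem_center (hc ?_) z
    rw [LinearMap.mem_ker, map_sub, f.map_bracket, hσ, hσ, hσ, sub_self]
  have hr : ∀ x y z, H.bracket z (σ (G.bracket x y)) = H.bracket z (H.bracket (σ x) (σ y)) := by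
    intro x y z
    rw [← sub_eq_zero, ← map_sub]
    refine H.bracket_center (hc ?_) z
    rw [LinearMap.mem_ker, map_sub, f.map_bracket, hσ, hσ, hσ, sub_self]
  refine ⟨fun a b x y hx hy => ⟨?_, fun h => ?_⟩, fun a b x y z hx hy => ?_⟩
  · simp only [LinearMap.compr₂_apply, LinearMap.compl₁₂_apply]
    rw [H.skew (hσg _ _ hx) (hσg _ _ hy), map_neg, map_smul, smul_eq_mul]
  · exact hφ _ _ (H.bracket_mem (hσg _ _ hx) (hσg _ _ hy)) h
  · simp only [LinearMap.compr₂_apply, LinearMap.compl₁₂_apply]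
    rw [hl, hr, hr, H.jacobi _ (hσg _ _ hx) (hσg _ _ hy), map_add, map_smul, smul_eq_mul]

/-- The kernel of a defining pair, together with the derived subalgebra, is bounded by the
cocycles. -/
theorem IsDefiningPair.finrank_add_le [FiniteDimensional F V] {G : LieSuperalgebra F V}
    {H : LieSuperalgebra F W} {M : Submodule F W} (h : IsDefiningPair G H M) (i : ZMod 2) :
    Module.finrank F ↥(M ⊓ H.grade i) + Module.finrank F ↥(G.derived ⊓ G.grade i) ≤
      Module.finrank F (G.cocycles i) := by
  obtain ⟨f, hf, rfl⟩ := h.exists_hom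
  obtain ⟨σ, hσ, hσg⟩ := f.exists_section hf
  obtain ⟨r, hr, hrh⟩ := H.exists_retraction (i := i)
    (U := LinearMap.ker f.toLinearMap ⊓ H.grade i) inf_le_right
  obtain ⟨q, hq, hqh⟩ := G.exists_retraction (i := i) (U := G.derived ⊓ G.grade i) inf_le_right
  have hbr : ∀ x y, H.bracket (σ (f.toLinearMap x)) (σ (f.toLinearMap y)) = H.bracket x y := by
    have hk : ∀ x, σ (f.toLinearMap x) - x ∈ H.center := fun x => h.le_center <| by
      rw [LinearMap.mem_ker, map_sub, hσ, sub_self]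
    intro x y
    have e1 := H.bracket_eq_zero_of_mem_center (hk x) (σ (f.toLinearMap y))
    have e2 := H.bracket_center (hk y) x
    rw [map_sub, LinearMap.sub_apply, sub_eq_zero] at e1
    rw [map_sub, sub_eq_zero] at e2
    rw [e1, e2]
  -- `Θ` sends a functional on the homogeneous part of the kernel and one on that of `G.derived` to
  -- the sum of an extension cocycle and a coboundary. Its injectivity is the desired bound.
  let Θ := (comprDual ((H.bracket.compl₁₂ σ σ).compr₂ r)).coprod
    (comprDual (G.bracket.compr₂ q))
  have hΘ : ∀ p, Θ p ∈ G.cocycles i := fun p => by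
    refine add_mem (section_mem_cocycles h.le_center hσ hσg (hrh.comp p.1)) ?_
    exact G.comp_bracket_mem_cocycles (hqh.comp p.2)
  have hinj : Function.Injective (Θ.codRestrict (G.cocycles i) hΘ) := by
    refine (injective_iff_map_eq_zero _).mpr ?_
    rintro ⟨ψ, μ⟩ h0
    replace h0 : Θ (ψ, μ) = 0 := congrArg Subtype.val h0
    have hval : ∀ x y, ψ (r (H.bracket (σ x) (σ y))) + μ (q (G.bracket x y)) = 0 :=
      fun x y => LinearMap.congr_fun (LinearMap.congr_fun h0 x) y
    -- Since the bracket of `H` only depends on images in `G`, a relation in the kernel of `Θ` says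
    -- that one functional kills all of `H.derived`. Evaluating it on the kernel, which lies in
    -- `H.derived`, gives `ψ = 0`; what remains kills `G.derived`, so `μ = 0`.
    have h1 : H.derived ≤ LinearMap.ker (ψ ∘ₗ r + μ ∘ₗ q ∘ₗ f.toLinearMap) := by
      refine Submodule.map₂_le.mpr fun x _ y _ => ?_
      rw [LinearMap.mem_ker, LinearMap.add_apply, LinearMap.comp_apply, LinearMap.comp_apply,
        LinearMap.comp_apply, f.map_bracket, ← hbr]
      exact hval _ _
    have hψ : ψ = 0 := by
      ext m
      have := h1 (h.le_derived m.2.1)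
      rw [LinearMap.mem_ker, LinearMap.add_apply, LinearMap.comp_apply, LinearMap.comp_apply,
        LinearMap.comp_apply, LinearMap.mem_ker.mp m.2.1, hr, map_zero, map_zero, add_zero] at this
      exact this
    subst hψ
    have h2 : G.derived ≤ LinearMap.ker (μ ∘ₗ q) := by
      refine Submodule.map₂_le.mpr fun x _ y _ => ?_
      simpa using hval x y
    have hμ : μ = 0 := by
      ext m
      have := h2 m.2.1
      rwa [LinearMap.mem_ker, LinearMap.comp_apply, hq] at this
    rw [hμ]; rfl
  -- `W` is not assumed finite-dimensional; finiteness of this part of the kernel comes from the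
  -- embedding itself.
  have hfin : Module.Finite F ((↥(LinearMap.ker f.toLinearMap ⊓ H.grade i) →ₗ[F] F) ×
      (↥(G.derived ⊓ G.grade i) →ₗ[F] F)) := Module.Finite.of_injective _ hinj
  have : Module.Finite F (↥(LinearMap.ker f.toLinearMap ⊓ H.grade i) →ₗ[F] F) :=
    Module.Finite.of_surjective (LinearMap.fst F _ (↥(G.derived ⊓ G.grade i) →ₗ[F] F))
      LinearMap.fst_surjective
  have := LinearMap.finrank_le_finrank_of_injective hinj
  rw [Module.finrank_prod] at this
  have e1 := Subspace.dual_finrank_eq (K := F) (V := ↥(LinearMap.ker f.toLinearMap ⊓ H.grade i))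
  have e2 := Subspace.dual_finrank_eq (K := F) (V := ↥(G.derived ⊓ G.grade i))
  rw [← e1, ← e2]
  exact this

/-! ### Lower bound: the extension by universal cocycles -/

/-- A finite-dimensional space has an isomorphic copy in the universe of any nontrivial space. -/
theorem exists_linearEquiv_universe (V : Type v) [AddCommGroup V] [Module F V] [Nontrivial V]
    (D : Type w) [AddCommGroup D] [Module F D] [FiniteDimensional F D] :
    ∃ (M : Type v) (_ : AddCommGroup M) (_ : Module F M), Nonempty (M ≃ₗ[F] D) := by
  obtain ⟨x, hx⟩ := exists_ne (0 : V)
  -- Defining pairs must live in the universe of `V`, while `F` may live in another; a line of `V`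
  -- serves as a copy of `F`.
  refine ⟨Fin (Module.finrank F D) → ↥(F ∙ x), inferInstance, inferInstance, ⟨?_⟩⟩
  exact (LinearEquiv.piCongrRight fun _ => (LinearEquiv.toSpanNonzeroSingleton F V x hx).symm).trans
    (Module.finBasis F D).equivFun.symm

/-- A complement to the range of an injective map, in dual form and in a prescribed universe. -/
theorem exists_dual_complement (V : Type v) [AddCommGroup V] [Module F V] [Nontrivial V]
    {Z E : Type*} [AddCommGroup Z] [Module F Z] [FiniteDimensional F Z] [AddCommGroup E]
    [Module F E] {β : E →ₗ[F] Z} (hβ : Function.Injective β) :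
    ∃ (M : Type v) (_ : AddCommGroup M) (_ : Module F M) (π : (Z →ₗ[F] F) →ₗ[F] M),
      Module.finrank F M + Module.finrank F E = Module.finrank F Z ∧
      ∀ ψ : M →ₗ[F] F, ∃ ω : Z, (∀ g, ψ (π g) = g ω) ∧ (ω ∈ LinearMap.range β → ψ = 0) := by
  obtain ⟨H, hH⟩ := (LinearMap.range β).exists_isCompl
  obtain ⟨M, i1, i2, ⟨e⟩⟩ := exists_linearEquiv_universe (F := F) V (Module.Dual F H)
  refine ⟨M, i1, i2, e.symm.toLinearMap ∘ₗ H.subtype.dualMap, ?_, fun ψ => ?_⟩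
  · have h1 := Submodule.finrank_add_eq_of_isCompl hH
    have h2 := LinearMap.finrank_range_of_inj hβ
    have h3 := e.finrank_eq
    have h4 := Subspace.dual_finrank_eq (K := F) (V := H)
    omega
  -- `M` is a copy of the dual of the complement `H`, so by reflexivity a functional on `M` is
  -- evaluation at some `ω ∈ H`. If `ω` also lies in the range of `β`, it vanishes.
  · obtain ⟨ω, hω⟩ := (Module.evalEquiv F H).surjective (ψ ∘ₗ e.symm.toLinearMap)
    have hω' : ∀ g : Module.Dual F H, g ω = ψ (e.symm g) := fun g => LinearMap.congr_fun hω g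
    refine ⟨ω, fun g => (hω' (H.subtype.dualMap g)).symm, fun h => ?_⟩
    have h0 : ω = 0 := Subtype.ext (Submodule.disjoint_def.mp hH.disjoint ω h ω.2)
    ext m
    have := hω' (e m)
    rw [h0, map_zero, e.symm_apply_apply] at this
    exact this.symm

/-- There is a cocycle of parity `i` with values in a space dual to the cohomology in parity `i`,
whose components are independent modulo coboundaries. -/
theorem exists_universal_cocycle (L : LieSuperalgebra F V) [FiniteDimensional F V] [Nontrivial V]
    (i : ZMod 2) :
    ∃ (M : Type v) (_ : AddCommGroup M) (_ : Module F M) (θ : V →ₗ[F] V →ₗ[F] M),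
      Module.finrank F M + Module.finrank F ↥(L.derived ⊓ L.grade i) =
        Module.finrank F (L.cocycles i) ∧
      (∀ ψ, comprDual θ ψ ∈ L.cocycles i) ∧
      ∀ (ψ : M →ₗ[F] F) (f : V →ₗ[F] F), L.IsHomFunctional i f →
        comprDual θ ψ + comprDual L.bracket f = 0 → ψ = 0 := by
  obtain ⟨q, hq, hqh⟩ := L.exists_retraction (i := i) (U := L.derived ⊓ L.grade i) inf_le_right
  let β := (comprDual (L.bracket.compr₂ q)).codRestrict (L.cocycles i)
    fun μ => L.comp_bracket_mem_cocycles (hqh.comp μ)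
  have hβ : Function.Injective β := by
    refine (injective_iff_map_eq_zero _).mpr fun μ h0 => ?_
    replace h0 : comprDual (L.bracket.compr₂ q) μ = 0 := congrArg Subtype.val h0
    have h2 : L.derived ≤ LinearMap.ker (μ ∘ₗ q) := by
      refine Submodule.map₂_le.mpr fun x _ y _ => ?_
      exact LinearMap.congr_fun (LinearMap.congr_fun h0 x) y
    ext m
    have := h2 m.2.1
    rwa [LinearMap.mem_ker, LinearMap.comp_apply, hq] at this
  obtain ⟨M, i1, i2, π, hdim, hπ⟩ := exists_dual_complement V hβ
  let ev : V →ₗ[F] V →ₗ[F] (L.cocycles i →ₗ[F] F) := LinearMap.mk₂ F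
    (fun x y => LinearMap.applyₗ y ∘ₗ LinearMap.applyₗ x ∘ₗ (L.cocycles i).subtype)
    (by intros; ext; simp) (by intros; ext; simp) (by intros; ext; simp) (by intros; ext; simp)
  have key : ∀ ψ : M →ₗ[F] F, ∃ ω : L.cocycles i, comprDual (ev.compr₂ π) ψ = ω.1 ∧
      (ω ∈ LinearMap.range β → ψ = 0) := fun ψ => by
    obtain ⟨ω, hω, h0⟩ := hπ ψ
    refine ⟨ω, ?_, h0⟩
    ext x y
    exact hω (ev x y)
  refine ⟨M, i1, i2, ev.compr₂ π, ?_, fun ψ => ?_, fun ψ f hf h => ?_⟩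
  · rw [← hdim]
    congr 1
    exact (Subspace.dual_finrank_eq (K := F) (V := ↥(L.derived ⊓ L.grade i))).symm
  · obtain ⟨ω, hω, -⟩ := key ψ
    rw [hω]
    exact ω.2
  · obtain ⟨ω, hω, h0⟩ := key ψ
    apply h0
    -- The relation exhibits `ω` as the coboundary of `-f`; only the values of `f` on the part of
    -- `L.derived` of parity `i` matter.
    refine ⟨-(f ∘ₗ (L.derived ⊓ L.grade i).subtype), Subtype.ext ?_⟩
    have : comprDual (L.bracket.compr₂ q) (f ∘ₗ (L.derived ⊓ L.grade i).subtype) =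
        comprDual L.bracket f := by
      refine L.bilinear_ext fun a b x y hx hy => ?_
      have hxy := L.bracket_mem hx hy
      simp only [comprDual_apply, LinearMap.compr₂_apply, LinearMap.comp_apply]
      by_cases hab : a + b = i
      · subst hab
        rw [hq ⟨_, L.bracket_mem_derived x y, hxy⟩]; rfl
      · rw [hqh _ _ hxy hab, hf _ _ hxy hab, map_zero, map_zero]
    change comprDual (L.bracket.compr₂ q) _ = ω.1
    rw [map_neg, this, ← hω]
    exact (eq_neg_of_add_eq_zero_left h).symm

/-- Reduces vector-valued cocycle identities to the scalar ones satisfied by each component. -/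
theorem ext_dual {x y : W} (h : ∀ ψ : W →ₗ[F] F, ψ x = ψ y) : x = y := by
  rw [← sub_eq_zero, ← Module.forall_dual_apply_eq_zero_iff F]
  intro ψ
  rw [map_sub, h ψ, sub_self]

section CentralExtension

variable {M₀ M₁ : Type*} [AddCommGroup M₀] [Module F M₀] [AddCommGroup M₁] [Module F M₁]

theorem val_eq_zero_of_parity {L : LieSuperalgebra F V} {i : ZMod 2} {θ : V →ₗ[F] V →ₗ[F] W}
    (hθ : ∀ ψ, comprDual θ ψ ∈ L.cocycles i) {a b : ZMod 2} {x y : V} (hx : x ∈ L.grade a)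
    (hy : y ∈ L.grade b) (h : a + b ≠ i) : θ x y = 0 :=
  ext_dual (F := F) fun ψ => by rw [map_zero]; exact ((hθ ψ).1 a b x y hx hy).2 h

theorem val_skew {L : LieSuperalgebra F V} {i : ZMod 2} {θ : V →ₗ[F] V →ₗ[F] W}
    (hθ : ∀ ψ, comprDual θ ψ ∈ L.cocycles i) {a b : ZMod 2} {x y : V} (hx : x ∈ L.grade a)
    (hy : y ∈ L.grade b) : θ x y = -((-1 : F) ^ (a.val * b.val) • θ y x) :=
  ext_dual (F := F) fun ψ => by
    rw [map_neg, map_smul]; exact ((hθ ψ).1 a b x y hx hy).1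

theorem val_jacobi {L : LieSuperalgebra F V} {i : ZMod 2} {θ : V →ₗ[F] V →ₗ[F] W}
    (hθ : ∀ ψ, comprDual θ ψ ∈ L.cocycles i) {a b : ZMod 2} {x y : V} (z : V)
    (hx : x ∈ L.grade a) (hy : y ∈ L.grade b) :
    θ x (L.bracket y z) =
      θ (L.bracket x y) z + (-1 : F) ^ (a.val * b.val) • θ y (L.bracket x z) :=
  ext_dual (F := F) fun ψ => by
    rw [map_add, map_smul]; exact (hθ ψ).2 a b x y z hx hy

/-- The central extension of `L` by an even cocycle and an odd cocycle. -/
def centralExtension (L : LieSuperalgebra F V) (θ₀ : V →ₗ[F] V →ₗ[F] M₀)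
    (θ₁ : V →ₗ[F] V →ₗ[F] M₁) (h₀ : ∀ ψ, comprDual θ₀ ψ ∈ L.cocycles 0)
    (h₁ : ∀ ψ, comprDual θ₁ ψ ∈ L.cocycles 1) : LieSuperalgebra F (V × (M₀ × M₁)) where
  grade i := (L.grade i).prod (prodGrade F M₀ M₁ i)
  isCompl := by
    constructor
    · rw [Submodule.disjoint_def]
      intro x h0 h1
      exact Prod.ext (Submodule.disjoint_def.mp L.isCompl.disjoint _ h0.1 h1.1)
        (Submodule.disjoint_def.mp isCompl_prodGrade.disjoint _ h0.2 h1.2)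
    · rw [codisjoint_iff, Submodule.prod_sup_prod, L.isCompl.sup_eq_top,
        isCompl_prodGrade.sup_eq_top, Submodule.prod_top]
  bracket := LinearMap.mk₂ F (fun x y => (L.bracket x.1 y.1, θ₀ x.1 y.1, θ₁ x.1 y.1))
    (by intros; simp) (by intros; simp) (by intros; simp) (by intros; simp)
  bracket_mem {a b x y} hx hy := by
    refine ⟨L.bracket_mem hx.1 hy.1, ?_⟩
    rcases zmod_two_cases (a + b) with h | h <;> rw [h]
    · exact mem_prodGrade_zero.mpr (val_eq_zero_of_parity h₁ hx.1 hy.1 (by rw [h]; decide))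
    · exact mem_prodGrade_one.mpr (val_eq_zero_of_parity h₀ hx.1 hy.1 (by rw [h]; decide))
  skew hx hy := Prod.ext (L.skew hx.1 hy.1)
    (Prod.ext (val_skew h₀ hx.1 hy.1) (val_skew h₁ hx.1 hy.1))
  jacobi z hx hy := Prod.ext (L.jacobi z.1 hx.1 hy.1)
    (Prod.ext (val_jacobi h₀ z.1 hx.1 hy.1) (val_jacobi h₁ z.1 hx.1 hy.1))

end CentralExtension

/-- The defining pair given by the universal cocycles. -/
theorem exists_mem_definingSdims (L : LieSuperalgebra F V) [FiniteDimensional F V]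
    [Nontrivial V] :
    ∃ d ∈ L.definingSdims,
      d.1 + Module.finrank F ↥(L.derived ⊓ L.grade 0) = Module.finrank F (L.cocycles 0) ∧
      d.2 + Module.finrank F ↥(L.derived ⊓ L.grade 1) = Module.finrank F (L.cocycles 1) := by
  obtain ⟨M₀, _, _, θ₀, hd₀, hc₀, hu₀⟩ := L.exists_universal_cocycle 0
  obtain ⟨M₁, _, _, θ₁, hd₁, hc₁, hu₁⟩ := L.exists_universal_cocycle 1
  let K := L.centralExtension θ₀ θ₁ hc₀ hc₁
  have hK : ∀ x y, K.bracket x y = (L.bracket x.1 y.1, θ₀ x.1 y.1, θ₁ x.1 y.1) := fun _ _ => rfl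
  let f : Hom K L := ⟨LinearMap.fst F V (M₀ × M₁), fun h => h.1, fun _ _ => rfl⟩
  have hmem : ∀ x, x ∈ LinearMap.ker f.toLinearMap ↔ x.1 = 0 := fun x => Iff.rfl
  refine ⟨(Module.finrank F M₀, Module.finrank F M₁),
    ⟨V × (M₀ × M₁), inferInstance, inferInstance, K, LinearMap.ker f.toLinearMap,
      ⟨⟨f, LinearMap.fst_surjective, rfl⟩, ?_, ?_⟩, ?_⟩, hd₀, hd₁⟩
  · intro m hm
    rw [hmem] at hm
    refine LinearMap.mem_ker.mpr (LinearMap.ext fun y => ?_)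
    rw [hK, hm]
    simp
  · intro m hm
    rw [hmem] at hm
    -- A kernel vector outside `K.derived` would be detected by some `χ` vanishing on all brackets.
    -- Splitting that vanishing by parity makes `ψ₀ ∘ θ₀` and `ψ₁ ∘ θ₁` coboundaries, so
    -- independence modulo coboundaries kills both `ψ₀` and `ψ₁`, and `χ` vanishes on the kernel
    -- after all.
    by_contra hcon
    obtain ⟨χ, hχ, hle⟩ := Submodule.exists_le_ker_of_notMem hcon
    let f₀ := χ ∘ₗ LinearMap.inl F V (M₀ × M₁)
    let ψ₀ := χ ∘ₗ LinearMap.inr F V (M₀ × M₁) ∘ₗ LinearMap.inl F M₀ M₁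
    let ψ₁ := χ ∘ₗ LinearMap.inr F V (M₀ × M₁) ∘ₗ LinearMap.inr F M₀ M₁
    have hsplit : ∀ p, χ p = f₀ p.1 + ψ₀ p.2.1 + ψ₁ p.2.2 := by
      intro p
      simp only [f₀, ψ₀, ψ₁, LinearMap.comp_apply, ← map_add]
      simp
    have hzero : ∀ x y, f₀ (L.bracket x y) + ψ₀ (θ₀ x y) + ψ₁ (θ₁ x y) = 0 := by
      intro x y
      have := hle (K.bracket_mem_derived (x, 0) (y, 0))
      rw [LinearMap.mem_ker, hsplit] at this
      exact this
    have e₀ : ψ₀ = 0 := by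
      refine hu₀ ψ₀ (f₀ ∘ₗ L.proj 0) (L.isHomFunctional_comp_proj 0 f₀)
        (L.bilinear_ext fun a b x y hx hy => ?_)
      have hxy := L.bracket_mem hx hy
      simp only [LinearMap.add_apply, comprDual_apply, LinearMap.comp_apply, LinearMap.zero_apply]
      by_cases h : a + b = 0
      · have h0 := hzero x y
        rw [val_eq_zero_of_parity hc₁ hx hy (by rw [h]; decide), map_zero, add_zero] at h0
        rw [h] at hxy
        rw [L.proj_of_mem hxy, add_comm, h0]
      · rw [L.proj_of_mem_of_ne hxy h, val_eq_zero_of_parity hc₀ hx hy h, map_zero, map_zero,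
          add_zero]
    have e₁ : ψ₁ = 0 := by
      refine hu₁ ψ₁ (f₀ ∘ₗ L.proj 1) (L.isHomFunctional_comp_proj 1 f₀)
        (L.bilinear_ext fun a b x y hx hy => ?_)
      have hxy := L.bracket_mem hx hy
      simp only [LinearMap.add_apply, comprDual_apply, LinearMap.comp_apply, LinearMap.zero_apply]
      by_cases h : a + b = 1
      · have h0 := hzero x y
        rw [val_eq_zero_of_parity hc₀ hx hy (by rw [h]; decide), map_zero, add_zero] at h0
        rw [h] at hxy
        rw [L.proj_of_mem hxy, add_comm, h0]
      · rw [L.proj_of_mem_of_ne hxy h, val_eq_zero_of_parity hc₁ hx hy h, map_zero, map_zero,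
          add_zero]
    apply hχ
    rw [hsplit, hm, e₀, e₁]
    simp
  · refine Prod.ext ?_ ?_
    · refine LinearEquiv.finrank_eq (LinearEquiv.ofBijective
        ((LinearMap.fst F M₀ M₁ ∘ₗ LinearMap.snd F V (M₀ × M₁)) ∘ₗ Submodule.subtype _) ⟨?_, ?_⟩)
      · rw [← LinearMap.ker_eq_bot, LinearMap.ker_eq_bot']
        rintro ⟨⟨x, y, z⟩, h1, h2, h3⟩ h4
        have h1' : x = 0 := h1
        have h3' := mem_prodGrade_zero.mp h3
        simp_all
      · intro m
        exact ⟨⟨(0, m, 0), rfl, zero_mem _, mem_prodGrade_zero.mpr rfl⟩, rfl⟩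
    · refine LinearEquiv.finrank_eq (LinearEquiv.ofBijective
        ((LinearMap.snd F M₀ M₁ ∘ₗ LinearMap.snd F V (M₀ × M₁)) ∘ₗ Submodule.subtype _) ⟨?_, ?_⟩)
      · rw [← LinearMap.ker_eq_bot, LinearMap.ker_eq_bot']
        rintro ⟨⟨x, y, z⟩, h1, h2, h3⟩ h4
        have h1' : x = 0 := h1
        have h3' := mem_prodGrade_one.mp h3
        simp_all
      · intro m
        exact ⟨⟨(0, 0, m), rfl, zero_mem _, mem_prodGrade_one.mpr rfl⟩, rfl⟩

/-- The multiplier is dual to the second cohomology with trivial coefficients. -/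
theorem sdimMultiplier_add_finrank_derived (L : LieSuperalgebra F V) [FiniteDimensional F V]
    [Nontrivial V] :
    L.sdimMultiplier.1 + Module.finrank F ↥(L.derived ⊓ L.grade 0) =
        Module.finrank F (L.cocycles 0) ∧
      L.sdimMultiplier.2 + Module.finrank F ↥(L.derived ⊓ L.grade 1) =
        Module.finrank F (L.cocycles 1) := by
  have hmax : Maximal (· ∈ L.definingSdims) L.sdimMultiplier :=
    L.exists_maximal_definingSdims.choose_spec
  obtain ⟨d, hd, h0, h1⟩ := L.exists_mem_definingSdims
  obtain ⟨K, _, _, H, M, hp, he⟩ := hmax.1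
  have b0 := hp.finrank_add_le 0
  have b1 := hp.finrank_add_le 1
  -- A maximal element need not be a greatest one for pairs; the cocycle bound shows that `d`
  -- dominates every attained superdimension.
  have hle : L.sdimMultiplier ≤ d := by
    rw [← he]
    refine Prod.mk_le_mk.mpr ⟨?_, ?_⟩ <;> omega
  rw [hle.antisymm (hmax.2 hd hle)]
  exact ⟨h0, h1⟩

/-! ### Dimensions of the skew forms and the formula for the rank -/

/-- The symmetric bilinear forms on `V`. -/
def symForms (F : Type u) [Field F] (V : Type v) [AddCommGroup V] [Module F V] :
    Submodule F (V →ₗ[F] V →ₗ[F] F) where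
  carrier := {h | ∀ x y, h x y = h y x}
  zero_mem' _ _ := rfl
  add_mem' ha hb x y := by simp only [LinearMap.add_apply]; rw [ha x y, hb x y]
  smul_mem' r _ ha x y := by simp only [LinearMap.smul_apply]; rw [ha x y]

/-- The skew-symmetric bilinear forms on `V`. -/
def altForms (F : Type u) [Field F] (V : Type v) [AddCommGroup V] [Module F V] :
    Submodule F (V →ₗ[F] V →ₗ[F] F) where
  carrier := {h | ∀ x y, h x y = -h y x}
  zero_mem' _ _ := by simp
  add_mem' ha hb x y := by simp only [LinearMap.add_apply]; rw [ha x y, hb x y]; ring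
  smul_mem' r _ ha x y := by simp only [LinearMap.smul_apply]; rw [ha x y, smul_neg]

theorem isCompl_symForms_altForms [CharZero F] : IsCompl (symForms F V) (altForms F V) := by
  constructor
  · rw [Submodule.disjoint_def]
    intro h hs ha
    ext x y
    have h1 : h x y = h y x := hs x y
    have h2 : h x y = -h y x := ha x y
    rw [← h1] at h2
    exact self_eq_neg.mp h2
  · rw [codisjoint_iff, eq_top_iff]
    intro h _
    refine Submodule.mem_sup.mpr ⟨(2⁻¹ : F) • (h + h.flip), fun x y => ?_,
      (2⁻¹ : F) • (h - h.flip), fun x y => ?_, ?_⟩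
    · simp [add_comm]
    · simp only [LinearMap.smul_apply, LinearMap.sub_apply, LinearMap.flip_apply, smul_eq_mul]
      ring
    · ext x y
      simp only [LinearMap.smul_apply, LinearMap.sub_apply, LinearMap.flip_apply, smul_eq_mul,
        LinearMap.add_apply]
      field_simp
      ring

/-- In a basis, a symmetric form is an arbitrary function on unordered pairs of indices. -/
theorem finrank_symForms [FiniteDimensional F V] :
    Module.finrank F (symForms F V) = (Module.finrank F V + 1).choose 2 := by
  let b := Module.finBasis F V
  let m : (Sym2 (Fin (Module.finrank F V)) → F) →ₗ[F] Matrix _ _ F :=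
    { toFun := fun g => Matrix.of fun i j => g s(i, j)
      map_add' := fun _ _ => rfl
      map_smul' := fun _ _ => rfl }
  let J := (Matrix.toLinearMap₂ b b).toLinearMap ∘ₗ m
  have hJ : ∀ g i j, J g (b i) (b j) = g s(i, j) := fun g i j =>
    Matrix.toLinearMap₂_apply_basis b b (m g) i j
  have hinj : Function.Injective J := by
    refine (injective_iff_map_eq_zero _).mpr fun g hg => ?_
    ext z
    induction z with
    | _ i j => rw [← hJ g, hg]; rfl
  have hrange : LinearMap.range J = symForms F V := by
    apply le_antisymm
    · rintro _ ⟨g, rfl⟩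
      change ∀ x y, J g x y = (J g).flip x y
      suffices J g = (J g).flip from fun x y => LinearMap.congr_fun (LinearMap.congr_fun this x) y
      refine LinearMap.ext_basis b b fun i j => ?_
      rw [LinearMap.flip_apply, hJ, hJ, Sym2.eq_swap]
    · intro h hh
      refine ⟨Sym2.lift ⟨fun i j => h (b i) (b j), fun i j => hh _ _⟩, ?_⟩
      refine LinearMap.ext_basis b b fun i j => ?_
      rw [hJ, Sym2.lift_mk]
  rw [← hrange, LinearMap.finrank_range_of_inj hinj, Module.finrank_fintype_fun_eq_card,
    Sym2.card, Fintype.card_fin]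

/-- Obtained by subtraction: all forms split into symmetric and skew ones, and the total dimension
is the square of that of `V`. -/
theorem finrank_altForms [CharZero F] [FiniteDimensional F V] :
    Module.finrank F (altForms F V) = (Module.finrank F V).choose 2 := by
  have h := Submodule.finrank_add_eq_of_isCompl (isCompl_symForms_altForms (F := F) (V := V))
  rw [finrank_symForms, Module.finrank_linearMap, Module.finrank_linearMap,
    Module.finrank_self, mul_one] at h
  have h2 : ∀ n : ℕ, (n + 1).choose 2 + n.choose 2 = n * n := by
    intro n
    induction n with
    | zero => rfl
    | succ n ih =>
      rw [Nat.choose_succ_succ' (n + 1) 1, Nat.choose_one_right]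
      have := Nat.choose_succ_succ' n 1
      rw [Nat.choose_one_right] at this
      nlinarith
  have := h2 (Module.finrank F V)
  omega

/-- Pulling back bilinear forms along a pair of linear maps. -/
def pullForm {U U' : Type*} [AddCommGroup U] [Module F U] [AddCommGroup U'] [Module F U']
    (p : V →ₗ[F] U) (q : V →ₗ[F] U') : (U →ₗ[F] U' →ₗ[F] F) →ₗ[F] (V →ₗ[F] V →ₗ[F] F) where
  toFun h := h.compl₁₂ p q
  map_add' _ _ := rfl
  map_smul' _ _ := rfl

/-- The projection onto the component of parity `i`, as a map to that component. -/
noncomputable def projOnto (L : LieSuperalgebra F V) (i : ZMod 2) : V →ₗ[F] L.grade i :=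
  (L.proj i).codRestrict (L.grade i) (L.proj_mem i)

theorem projOnto_coe (L : LieSuperalgebra F V) {i : ZMod 2} (x : L.grade i) :
    L.projOnto i x = x := Subtype.ext (L.proj_of_mem x.2)

theorem projOnto_of_mem (L : LieSuperalgebra F V) {i : ZMod 2} {x : V} (hx : x ∈ L.grade i) :
    L.projOnto i x = ⟨x, hx⟩ := Subtype.ext (L.proj_of_mem hx)

theorem projOnto_of_mem_of_ne (L : LieSuperalgebra F V) {i j : ZMod 2} {x : V}
    (hx : x ∈ L.grade j) (h : j ≠ i) : L.projOnto i x = 0 :=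
  Subtype.ext (L.proj_of_mem_of_ne hx h)

theorem sign_zero_left (j : ZMod 2) : (-1 : F) ^ ((0 : ZMod 2).val * j.val) = 1 := by
  simp

theorem sign_zero_right (j : ZMod 2) : (-1 : F) ^ (j.val * (0 : ZMod 2).val) = 1 := by
  simp

theorem sign_one_one : (-1 : F) ^ ((1 : ZMod 2).val * (1 : ZMod 2).val) = -1 := by
  simp [ZMod.val_one]

/-- An even form has no mixed block, and the sign rule makes it skew on the even part and symmetric
on the odd part. -/
theorem finrank_skewForms_zero [CharZero F] [FiniteDimensional F V] (L : LieSuperalgebra F V) :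
    Module.finrank F (L.skewForms 0) =
      (Module.finrank F (L.grade 0)).choose 2 + (Module.finrank F (L.grade 1) + 1).choose 2 := by
  let J := (pullForm (L.projOnto 0) (L.projOnto 0) ∘ₗ (altForms F (L.grade 0)).subtype).coprod
    (pullForm (L.projOnto 1) (L.projOnto 1) ∘ₗ (symForms F (L.grade 1)).subtype)
  have hJ : ∀ p x y, J p x y = p.1.1 (L.projOnto 0 x) (L.projOnto 0 y) +
    p.2.1 (L.projOnto 1 x) (L.projOnto 1 y) := fun _ _ _ => rfl
  have hinj : Function.Injective J := by
    refine (injective_iff_map_eq_zero _).mpr fun p hp => ?_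
    have h0 : ∀ x y, p.1.1 (L.projOnto 0 x) (L.projOnto 0 y) +
        p.2.1 (L.projOnto 1 x) (L.projOnto 1 y) = 0 := fun x y => by rw [← hJ, hp]; rfl
    refine Prod.ext (Subtype.ext ?_) (Subtype.ext ?_)
    · ext x y
      simpa [projOnto_coe, L.projOnto_of_mem_of_ne x.2 zero_ne_one] using h0 x y
    · ext x y
      simpa [projOnto_coe, L.projOnto_of_mem_of_ne x.2 one_ne_zero] using h0 x y
  have hrange : LinearMap.range J = L.skewForms 0 := by
    apply le_antisymm
    · rintro _ ⟨⟨⟨h0, hh0⟩, ⟨h1, hh1⟩⟩, rfl⟩ a b x y hx hy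
      simp only [hJ]
      rcases zmod_two_cases a with rfl | rfl <;> rcases zmod_two_cases b with rfl | rfl
      · rw [L.projOnto_of_mem_of_ne hx zero_ne_one, L.projOnto_of_mem_of_ne hy zero_ne_one,
          sign_zero_left, hh0]
        simp
      · rw [L.projOnto_of_mem_of_ne hx zero_ne_one, L.projOnto_of_mem_of_ne hy one_ne_zero]
        simp
      · rw [L.projOnto_of_mem_of_ne hy zero_ne_one, L.projOnto_of_mem_of_ne hx one_ne_zero]
        simp
      · rw [L.projOnto_of_mem_of_ne hx one_ne_zero, L.projOnto_of_mem_of_ne hy one_ne_zero,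
          sign_one_one, hh1]
        simp [show (1 : ZMod 2) + 1 = 0 from rfl]
    · intro ω hω
      refine ⟨(⟨ω.compl₁₂ (L.grade 0).subtype (L.grade 0).subtype, fun x y => ?_⟩,
        ⟨ω.compl₁₂ (L.grade 1).subtype (L.grade 1).subtype, fun x y => ?_⟩), ?_⟩
      · have := (hω 0 0 x y x.2 y.2).1
        rwa [sign_zero_left, one_mul] at this
      · have := (hω 1 1 x y x.2 y.2).1
        rwa [sign_one_one, neg_one_mul, neg_neg] at this
      · refine L.bilinear_ext fun a b x y hx hy => ?_
        rw [hJ]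
        simp only [LinearMap.compl₁₂_apply, Submodule.subtype_apply]
        rcases zmod_two_cases a with rfl | rfl <;> rcases zmod_two_cases b with rfl | rfl
        · rw [L.projOnto_of_mem_of_ne hx zero_ne_one, L.projOnto_of_mem hx, L.projOnto_of_mem hy]
          simp
        · rw [L.projOnto_of_mem_of_ne hx zero_ne_one, L.projOnto_of_mem_of_ne hy one_ne_zero,
            (hω 0 1 x y hx hy).2 (by decide)]
          simp
        · rw [L.projOnto_of_mem_of_ne hy zero_ne_one, L.projOnto_of_mem_of_ne hx one_ne_zero,
            (hω 1 0 x y hx hy).2 (by decide)]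
          simp
        · rw [L.projOnto_of_mem_of_ne hx one_ne_zero, L.projOnto_of_mem hx, L.projOnto_of_mem hy]
          simp
  rw [← hrange, LinearMap.finrank_range_of_inj hinj, Module.finrank_prod, finrank_altForms,
    finrank_symForms]

/-- Only the mixed blocks survive, and the even-odd block determines the odd-even one by ordinary
skew-symmetry. -/
theorem finrank_skewForms_one [FiniteDimensional F V] (L : LieSuperalgebra F V) :
    Module.finrank F (L.skewForms 1) =
      Module.finrank F (L.grade 0) * Module.finrank F (L.grade 1) := by
  let P := pullForm (F := F) (L.projOnto 0) (L.projOnto 1)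
  let J := P - LinearMap.lflip.toLinearMap ∘ₗ P
  have hJ : ∀ h x y, J h x y = h (L.projOnto 0 x) (L.projOnto 1 y) -
    h (L.projOnto 0 y) (L.projOnto 1 x) := fun _ _ _ => rfl
  have hinj : Function.Injective J := by
    refine (injective_iff_map_eq_zero _).mpr fun h hh => ?_
    ext x y
    have h0 : J h x y = 0 := by rw [hh]; rfl
    rw [hJ, projOnto_coe, projOnto_coe, L.projOnto_of_mem_of_ne y.2 one_ne_zero] at h0
    simpa using h0
  have hrange : LinearMap.range J = L.skewForms 1 := by
    apply le_antisymm
    · rintro _ ⟨h, rfl⟩ a b x y hx hy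
      simp only [hJ]
      rcases zmod_two_cases a with rfl | rfl <;> rcases zmod_two_cases b with rfl | rfl
      · rw [L.projOnto_of_mem_of_ne hx zero_ne_one, L.projOnto_of_mem_of_ne hy zero_ne_one]
        simp
      · rw [sign_zero_left]
        simp
      · rw [sign_zero_right]
        simp
      · rw [L.projOnto_of_mem_of_ne hx one_ne_zero, L.projOnto_of_mem_of_ne hy one_ne_zero]
        simp
    · intro ω hω
      refine ⟨ω.compl₁₂ (L.grade 0).subtype (L.grade 1).subtype,
        L.bilinear_ext fun a b x y hx hy => ?_⟩
      rw [hJ]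
      simp only [LinearMap.compl₁₂_apply, Submodule.subtype_apply]
      rcases zmod_two_cases a with rfl | rfl <;> rcases zmod_two_cases b with rfl | rfl
      · rw [L.projOnto_of_mem_of_ne hx zero_ne_one, L.projOnto_of_mem_of_ne hy zero_ne_one,
          (hω 0 0 x y hx hy).2 (by decide)]
        simp
      · rw [L.projOnto_of_mem_of_ne hx zero_ne_one, L.projOnto_of_mem hx, L.projOnto_of_mem hy]
        simp
      · rw [L.projOnto_of_mem_of_ne hx one_ne_zero, L.projOnto_of_mem hx, L.projOnto_of_mem hy,
          (hω 1 0 x y hx hy).1, sign_zero_right]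
        simp
      · rw [L.projOnto_of_mem_of_ne hx one_ne_zero, L.projOnto_of_mem_of_ne hy one_ne_zero,
          (hω 1 1 x y hx hy).2 (by decide)]
        simp
  rw [← hrange, LinearMap.finrank_range_of_inj hinj, Module.finrank_linearMap,
    Module.finrank_linearMap, Module.finrank_self, mul_one]

/-- The super-multiplier-rank measures the derived subalgebra and the skew forms that are not
cocycles. -/
theorem smr_eq [CharZero F] [FiniteDimensional F V] [Nontrivial V] (L : LieSuperalgebra F V) :
    L.smr = ((Module.finrank F ↥(L.derived ⊓ L.grade 0) + Module.finrank F (L.skewForms 0) -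
        Module.finrank F (L.cocycles 0) : ℤ),
      (Module.finrank F ↥(L.derived ⊓ L.grade 1) + Module.finrank F (L.skewForms 1) -
        Module.finrank F (L.cocycles 1) : ℤ)) := by
  obtain ⟨h0, h1⟩ := L.sdimMultiplier_add_finrank_derived
  have hch : ∀ n : ℕ, ((n.choose 2 : ℕ) : ℤ) = n * (n - 1) / 2 := by
    intro n
    rw [Nat.choose_two_right]
    cases n <;> simp
  rw [finrank_skewForms_zero, finrank_skewForms_one, ← h0, ← h1]
  have e : (((Module.finrank F (L.grade 1) + 1).choose 2 : ℕ) : ℤ) =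
      Module.finrank F (L.grade 1) * (Module.finrank F (L.grade 1) + 1) / 2 := by
    rw [hch]
    push_cast
    ring_nf
  simp only [smr, sdim, Nat.cast_add, Nat.cast_mul, hch (Module.finrank F (L.grade 0)), e]
  refine Prod.ext ?_ ?_
  · simp only [Prod.fst_sub]; ring
  · simp only [Prod.snd_sub]; ring

/-! ### Skew forms that are not cocycles -/

/-- Rank-nullity on `S`: independent linear conditions cut the dimension by their number. -/
theorem finrank_inf_ker_add [FiniteDimensional F V] [FiniteDimensional F W] (S : Submodule F V)
    (Φ : V →ₗ[F] W) (h : ∀ q, ∃ s ∈ S, Φ s = q) :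
    Module.finrank F ↥(S ⊓ LinearMap.ker Φ) + Module.finrank F W = Module.finrank F S := by
  have hrange : LinearMap.range (Φ.domRestrict S) = ⊤ := by
    refine LinearMap.range_eq_top.mpr fun q => ?_
    obtain ⟨s, hs, rfl⟩ := h q
    exact ⟨⟨s, hs⟩, rfl⟩
  have hker : (LinearMap.ker (Φ.domRestrict S)).map S.subtype = S ⊓ LinearMap.ker Φ := by
    ext x
    simp only [Submodule.mem_map, LinearMap.mem_ker, Submodule.mem_inf]
    constructor
    · rintro ⟨y, hy, rfl⟩
      exact ⟨y.2, hy⟩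
    · rintro ⟨hx, hx'⟩
      exact ⟨⟨x, hx⟩, hx', rfl⟩
  have h1 := (Φ.domRestrict S).finrank_range_add_finrank_ker
  rw [hrange, finrank_top, ← Submodule.finrank_map_subtype_eq S, hker] at h1
  omega

/-- The product of two homogeneous functionals in the super exterior algebra. -/
def wedge (i j : ZMod 2) (f g : V →ₗ[F] F) : V →ₗ[F] V →ₗ[F] F :=
  LinearMap.mk₂ F (fun x y => f x * g y - (-1 : F) ^ (i.val * j.val) * (g x * f y))
    (by intros; simp only [map_add]; ring) (by intros; simp only [map_smul, smul_eq_mul]; ring)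
    (by intros; simp only [map_add]; ring) (by intros; simp only [map_smul, smul_eq_mul]; ring)

theorem wedge_apply (i j : ZMod 2) (f g : V →ₗ[F] F) (x y : V) :
    wedge i j f g x y = f x * g y - (-1 : F) ^ (i.val * j.val) * (g x * f y) := rfl

theorem wedge_mem_skewForms {L : LieSuperalgebra F V} {i j : ZMod 2} {f g : V →ₗ[F] F}
    (hf : L.IsHomFunctional i f) (hg : L.IsHomFunctional j g) :
    wedge i j f g ∈ L.skewForms (i + j) := by
  intro a b x y hx hy
  simp only [wedge_apply]
  have h1 := hf a x hx
  have h2 := hf b y hy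
  have h3 := hg a x hx
  have h4 := hg b y hy
  by_cases hai : a = i
  · subst hai
    by_cases hbj : b = j
    · subst hbj
      refine ⟨?_, fun h => absurd rfl h⟩
      have hs : (-1 : F) ^ (a.val * b.val) * (-1 : F) ^ (a.val * b.val) = 1 := by
        rw [← mul_pow]; simp
      linear_combination (-(f x * g y)) * hs
    · rw [h4 hbj]
      by_cases hba : b = a
      · subst hba
        rw [h3 hbj]
        simp
      · rw [h2 hba]
        simp
  · rw [h1 hai]
    by_cases haj : a = j
    · subst haj
      by_cases hbi : b = i
      · subst hbi
        refine ⟨?_, fun h => absurd (add_comm _ _) h⟩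
        rw [mul_comm b.val a.val]
        ring
      · rw [h2 hbi]
        simp
    · rw [h3 haj]
      simp

/-- Homogeneous functionals separate homogeneous vectors from homogeneous subspaces. -/
theorem exists_functional (L : LieSuperalgebra F V) {i : ZMod 2} {c : V} (hc : c ∈ L.grade i)
    {U : Submodule F V} (hU : U ≤ L.grade i) (hcU : c ∉ U) :
    ∃ f : V →ₗ[F] F, L.IsHomFunctional i f ∧ f c = 1 ∧ ∀ x ∈ U, f x = 0 := by
  obtain ⟨f, hfc, hfU⟩ := Submodule.exists_le_ker_of_notMem hcU
  refine ⟨((f c)⁻¹ • f) ∘ₗ L.proj i, L.isHomFunctional_comp_proj i _, ?_, fun x hx => ?_⟩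
  · rw [LinearMap.comp_apply, L.proj_of_mem hc, LinearMap.smul_apply, smul_eq_mul,
      inv_mul_cancel₀ hfc]
  · rw [LinearMap.comp_apply, L.proj_of_mem (hU hx), LinearMap.smul_apply,
      LinearMap.mem_ker.mp (hfU hx), smul_zero]

theorem exists_functional_eq_one (L : LieSuperalgebra F V) {i : ZMod 2} {c : V}
    (hc : c ∈ L.grade i) (h0 : c ≠ 0) : ∃ f : V →ₗ[F] F, L.IsHomFunctional i f ∧ f c = 1 := by
  obtain ⟨f, hf, hfc, -⟩ := L.exists_functional hc (U := ⊥) bot_le (by simpa using h0)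
  exact ⟨f, hf, hfc⟩

/-- The cocycle identity for `c, x, y` expresses `ω c [x,y]` through `[c,x]` and `[c,y]`, both zero.
This is the source of all the obstructions below. -/
theorem cocycle_center_derived {L : LieSuperalgebra F V} {i p : ZMod 2}
    {ω : V →ₗ[F] V →ₗ[F] F} (hω : ω ∈ L.cocycles i) {c d : V} (hc : c ∈ L.grade p)
    (hcc : c ∈ L.center) (hd : d ∈ L.derived) : ω c d = 0 := by
  suffices L.derived ≤ LinearMap.ker (ω c) from this hd
  refine L.derived_le fun a b x y hx hy => ?_
  rw [LinearMap.mem_ker, hω.2 p a c x y hc hx, L.bracket_eq_zero_of_mem_center hcc,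
    L.bracket_eq_zero_of_mem_center hcc]
  simp

/-- A skew form that pairs a central vector nontrivially with a commutator is not a cocycle. -/
theorem finrank_cocycles_lt [FiniteDimensional F V] {L : LieSuperalgebra F V} {i p : ZMod 2}
    {ω : V →ₗ[F] V →ₗ[F] F} (hω : ω ∈ L.skewForms i) {c d : V} (hc : c ∈ L.grade p)
    (hcc : c ∈ L.center) (hd : d ∈ L.derived) (h : ω c d ≠ 0) :
    Module.finrank F (L.cocycles i) < Module.finrank F (L.skewForms i) := by
  refine Submodule.finrank_lt_finrank_of_lt (lt_of_le_of_ne (L.cocycles_le_skewForms i) ?_)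
  intro e
  rw [← e] at hω
  exact h (cocycle_center_derived hω hc hcc hd)

/-- For an odd functional `f` the form `wedge 1 1 f f` is symmetric rather than zero: with `f c = 1`
it takes the value 2 on `(c, c)`. -/
theorem finrank_cocycles_lt_of_odd [CharZero F] [FiniteDimensional F V] {L : LieSuperalgebra F V}
    {c : V} (hc : c ∈ L.grade 1) (h0 : c ≠ 0) (hcc : c ∈ L.center) (hd : c ∈ L.derived) :
    Module.finrank F (L.cocycles 0) < Module.finrank F (L.skewForms 0) := by
  obtain ⟨f, hf, hfc⟩ := L.exists_functional_eq_one hc h0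
  refine finrank_cocycles_lt (wedge_mem_skewForms hf hf) hc hcc hd ?_
  rw [wedge_apply, sign_one_one, hfc]
  norm_num

theorem finrank_cocycles_lt_of_even_odd [FiniteDimensional F V] {L : LieSuperalgebra F V}
    {c d : V} (hc : c ∈ L.grade 0) (h0 : c ≠ 0) (hcc : c ∈ L.center) (hd : d ∈ L.grade 1)
    (hd0 : d ≠ 0) (hdd : d ∈ L.derived) :
    Module.finrank F (L.cocycles 1) < Module.finrank F (L.skewForms 1) := by
  obtain ⟨f, hf, hfc⟩ := L.exists_functional_eq_one hc h0
  obtain ⟨g, hg, hgd⟩ := L.exists_functional_eq_one hd hd0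
  refine finrank_cocycles_lt (wedge_mem_skewForms hf hg) hc hcc hdd ?_
  rw [wedge_apply, hfc, hgd, hf _ _ hd one_ne_zero]
  simp

theorem finrank_cocycles_lt_of_even_even [FiniteDimensional F V] {L : LieSuperalgebra F V}
    {c d : V} (hc : c ∈ L.grade 0) (hcc : c ∈ L.center) (hd : d ∈ L.grade 0)
    (hdd : d ∈ L.derived) (h0 : c ≠ 0) (hcd : d ∉ F ∙ c) :
    Module.finrank F (L.cocycles 0) < Module.finrank F (L.skewForms 0) := by
  obtain ⟨f, hf, hfc⟩ := L.exists_functional_eq_one hc h0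
  obtain ⟨g, hg, hgd, hgc⟩ := L.exists_functional hd
    (U := F ∙ c) ((Submodule.span_singleton_le_iff_mem _ _).mpr hc) hcd
  refine finrank_cocycles_lt (wedge_mem_skewForms hf hg) hc hcc hdd ?_
  rw [wedge_apply, hfc, hgd, hgc c (Submodule.mem_span_singleton_self c)]
  simp

theorem exists_homogeneous_bracket_ne_zero {L : LieSuperalgebra F V} (hab : ¬ L.IsAbelian) :
    ∃ a b x y, x ∈ L.grade a ∧ y ∈ L.grade b ∧ L.bracket x y ≠ 0 := by
  by_contra! h
  have : L.bracket = 0 := L.bilinear_ext fun a b x y hx hy => h a b x y hx hy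
  exact hab fun x y => by rw [this]; rfl

/-- If the derived subalgebra is spanned by an odd vector, the even cocycles have codimension at
least two in the even skew forms. -/
theorem finrank_cocycles_add_two_le [CharZero F] [FiniteDimensional F V] {L : LieSuperalgebra F V}
    (hab : ¬ L.IsAbelian) {c : V} (hc : c ∈ L.grade 1) (hcc : c ∈ L.center)
    (hder : L.derived ≤ F ∙ c) :
    Module.finrank F (L.cocycles 0) + 2 ≤ Module.finrank F (L.skewForms 0) := by
  have hodd : ∀ x, x ∈ L.derived → x ∈ L.grade 1 := fun x hx =>
    (Submodule.span_singleton_le_iff_mem _ _).mpr hc (hder hx)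
  have heven : ∀ x, x ∈ L.derived → x ∈ L.grade 0 → x = 0 := fun x hx h0 =>
    L.eq_zero_of_mem_grade one_ne_zero h0 (hodd x hx)
  obtain ⟨x, y, hx, hy, hxy⟩ : ∃ x y, x ∈ L.grade 0 ∧ y ∈ L.grade 1 ∧ L.bracket x y ≠ 0 := by
    obtain ⟨a, b, x, y, hx, hy, hxy⟩ := exists_homogeneous_bracket_ne_zero hab
    rcases zmod_two_cases a with rfl | rfl <;> rcases zmod_two_cases b with rfl | rfl
    · exact absurd (heven _ (L.bracket_mem_derived x y) (L.bracket_mem hx hy)) hxy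
    · exact ⟨x, y, hx, hy, hxy⟩
    · exact ⟨y, x, hy, hx, fun h => hxy (L.bracket_eq_zero_comm hy hx h)⟩
    · exact absurd (heven _ (L.bracket_mem_derived x y) (L.bracket_mem hx hy)) hxy
  obtain ⟨t, ht⟩ := Submodule.mem_span_singleton.mp (hder (L.bracket_mem_derived x y))
  have ht0 : t ≠ 0 := by
    rintro rfl
    exact hxy (by rw [← ht, zero_smul])
  have hc0 : c ≠ 0 := by
    rintro rfl
    exact hxy (by rw [← ht, smul_zero])
  have hyc : y ∉ F ∙ c := fun h => by
    obtain ⟨s, rfl⟩ := Submodule.mem_span_singleton.mp h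
    rw [map_smul, L.bracket_center hcc, smul_zero] at hxy
    exact hxy rfl
  have hcy : c ∉ F ∙ y := fun h => by
    obtain ⟨s, hs⟩ := Submodule.mem_span_singleton.mp h
    have hs0 : s ≠ 0 := by
      rintro rfl
      exact hc0 (by rw [← hs, zero_smul])
    exact hyc (Submodule.mem_span_singleton.mpr ⟨s⁻¹, by rw [← hs, inv_smul_smul₀ hs0]⟩)
  obtain ⟨f, hf, hfc, hfy⟩ := L.exists_functional hc
    ((Submodule.span_singleton_le_iff_mem _ _).mpr hy) hcy
  obtain ⟨g, hg, hgy, hgc⟩ := L.exists_functional hy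
    ((Submodule.span_singleton_le_iff_mem _ _).mpr hc) hyc
  replace hfy := hfy y (Submodule.mem_span_singleton_self y)
  replace hgc := hgc c (Submodule.mem_span_singleton_self c)
  -- Two independent conditions satisfied by every even cocycle: vanishing on `(c, c)` and on `(c,
  -- y)`, where `[x,y]` is a nonzero multiple of `c`.
  let Φ : (V →ₗ[F] V →ₗ[F] F) →ₗ[F] F × F :=
    (LinearMap.applyₗ c ∘ₗ LinearMap.applyₗ c).prod (LinearMap.applyₗ y ∘ₗ LinearMap.applyₗ c)
  have hΦ : ∀ ω, Φ ω = (ω c c, ω c y) := fun _ => rfl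
  have h1 := finrank_inf_ker_add (L.skewForms 0) Φ fun q => by
    -- The division by 2 compensates for the square of `f` taking the value 2 on `(c, c)`.
    refine ⟨(q.1 / 2) • wedge 1 1 f f + q.2 • wedge 1 1 f g,
      add_mem (Submodule.smul_mem _ _ (wedge_mem_skewForms hf hf))
        (Submodule.smul_mem _ _ (wedge_mem_skewForms hf hg)), ?_⟩
    rw [hΦ]
    simp only [LinearMap.add_apply, LinearMap.smul_apply, wedge_apply, sign_one_one, hfc, hfy, hgc,
      hgy, smul_eq_mul]
    refine Prod.ext ?_ ?_ <;> (simp; try ring)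
  have h2 : L.cocycles 0 ≤ L.skewForms 0 ⊓ LinearMap.ker Φ := by
    intro ω hω
    refine ⟨hω.1, ?_⟩
    have hcd : c ∈ L.derived := by
      have := Submodule.smul_mem _ t⁻¹ (L.bracket_mem_derived x y)
      rwa [← ht, inv_smul_smul₀ ht0] at this
    -- Here `[y,y]` is even but lies in an odd line, so it is zero. The two remaining terms agree
    -- because `ω` is symmetric on odd vectors, leaving `2 t ω(c,y) = 0`.
    have e1 := hω.2 0 1 x y y hx hy
    rw [heven _ (L.bracket_mem_derived y y) (L.bracket_mem hy hy), ← ht, map_zero, map_smul,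
      map_smul, LinearMap.smul_apply, sign_zero_left, (hω.1 1 1 y c hy hc).1, sign_one_one,
      smul_eq_mul, smul_eq_mul] at e1
    have e2 : 2 * t * ω c y = 0 := by linear_combination -e1
    rw [SetLike.mem_coe, LinearMap.mem_ker, hΦ, cocycle_center_derived hω hc hcc hcd]
    refine Prod.ext rfl ?_
    simpa [ht0] using e2
  have h3 := Submodule.finrank_mono h2
  rw [Module.finrank_prod, Module.finrank_self] at h1
  omega

/-! ### Derived subalgebra an even line: the rank as a superdimension -/

theorem finrank_inf_ker_add_one [FiniteDimensional F V] {U : Submodule F V} {γ : V →ₗ[F] F} {c : V}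
    (hcU : c ∈ U) (hγ : γ c = 1) :
    Module.finrank F ↥(U ⊓ LinearMap.ker γ) + 1 = Module.finrank F U := by
  have h := finrank_inf_ker_add U γ fun q =>
    ⟨q • c, U.smul_mem _ hcU, by rw [map_smul, hγ, smul_eq_mul, mul_one]⟩
  rwa [Module.finrank_self] at h

/-- The codimension of the skew forms whose contraction with an even vector `c` vanishes on a
homogeneous subspace. -/
theorem finrank_skewForms_eq [FiniteDimensional F V] {L : LieSuperalgebra F V} {i : ZMod 2} {c : V}
    (hc : c ∈ L.grade 0) {γ : V →ₗ[F] F} (hγ : L.IsHomFunctional 0 γ) (hγc : γ c = 1)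
    {Q : Submodule F V} (hQ : Q ≤ L.grade i) (hQγ : Q ≤ LinearMap.ker γ) :
    ∃ S : Submodule F (V →ₗ[F] V →ₗ[F] F),
      (∀ ω, ω ∈ S ↔ ω ∈ L.skewForms i ∧ ∀ z ∈ Q, ω c z = 0) ∧
      Module.finrank F S + Module.finrank F Q = Module.finrank F (L.skewForms i) := by
  let Φ : (V →ₗ[F] V →ₗ[F] F) →ₗ[F] Module.Dual F Q :=
    Q.subtype.dualMap ∘ₗ LinearMap.applyₗ c
  have hΦ : ∀ ω (z : Q), Φ ω z = ω c z := fun _ _ => rfl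
  refine ⟨L.skewForms i ⊓ LinearMap.ker Φ, fun ω => ?_, ?_⟩
  · refine and_congr Iff.rfl ⟨fun h z hz => ?_, fun h => ?_⟩
    · rw [← hΦ ω ⟨z, hz⟩, LinearMap.mem_ker.mp h]; rfl
    · exact LinearMap.ext fun z => h z z.2
  · rw [← Subspace.dual_finrank_eq (K := F) (V := Q)]
    refine finrank_inf_ker_add _ Φ fun f => ?_
    obtain ⟨r, hr, hrh⟩ := L.exists_retraction hQ
    let g : V →ₗ[F] F := f ∘ₗ r ∘ₗ (LinearMap.id - γ.smulRight c)
    have hg : ∀ x, g x = f (r (x - γ x • c)) := fun _ => rfl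
    have hgh : L.IsHomFunctional i g := by
      intro j x hx hj
      rw [hg]
      have : x - γ x • c ∈ L.grade j := by
        rcases zmod_two_cases j with rfl | rfl
        · exact sub_mem hx (Submodule.smul_mem _ _ hc)
        · rwa [hγ _ _ hx one_ne_zero, zero_smul, sub_zero]
      rw [hrh _ _ this hj, map_zero]
    have hw := wedge_mem_skewForms hγ hgh
    rw [zero_add] at hw
    refine ⟨_, hw, LinearMap.ext fun z => ?_⟩
    rw [hΦ, wedge_apply, LinearMap.mem_ker.mp (hQγ z.2), hγc, hg,
      LinearMap.mem_ker.mp (hQγ z.2), zero_smul, sub_zero, hr]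
    ring

theorem skewForm_self_eq_zero [CharZero F] {L : LieSuperalgebra F V} {i : ZMod 2}
    {ω : V →ₗ[F] V →ₗ[F] F} (hω : ω ∈ L.skewForms i) {c : V} (hc : c ∈ L.grade 0) :
    ω c c = 0 := by
  have := (hω 0 0 c c hc hc).1
  rw [sign_zero_left, one_mul] at this
  exact self_eq_neg.mp this

theorem finrank_derived_zero_of_even {L : LieSuperalgebra F V} {c : V} (hc : c ∈ L.grade 0)
    (h0 : c ≠ 0) (hder : L.derived = F ∙ c) :
    Module.finrank F ↥(L.derived ⊓ L.grade 0) = 1 := by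
  rw [inf_eq_left.mpr (hder.le.trans ((Submodule.span_singleton_le_iff_mem _ _).mpr hc)), hder,
    finrank_span_singleton h0]

theorem finrank_derived_one_of_even {L : LieSuperalgebra F V} {c : V} (hc : c ∈ L.grade 0)
    (hder : L.derived = F ∙ c) : Module.finrank F ↥(L.derived ⊓ L.grade 1) = 0 := by
  have : L.derived ⊓ L.grade 1 = ⊥ := by
    refine (Submodule.eq_bot_iff _).mpr fun x hx => ?_
    refine L.eq_zero_of_mem_grade zero_ne_one hx.2 ?_
    exact (Submodule.span_singleton_le_iff_mem _ _).mpr hc (hder ▸ hx.1)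
  rw [this, finrank_bot]

section EvenDerived

variable [CharZero F] [FiniteDimensional F V] [Nontrivial V] {L : LieSuperalgebra F V} {c : V}
  {P : Submodule F V}

/-- If the derived subalgebra is spanned by the even vector `c` and cocycles pair `c` trivially
with `P ∋ c`, then the superdimension of `P` is a lower bound for the super-multiplier-rank. -/
theorem sdimSub_le_smr (hc : c ∈ L.grade 0) (h0 : c ≠ 0) (hder : L.derived = F ∙ c) (hcP : c ∈ P)
    (hP : ∀ i, ∀ ω ∈ L.cocycles i, ∀ z ∈ P, z ∈ L.grade i → ω c z = 0) :
    (Module.finrank F ↥(P ⊓ L.grade 0) : ℤ) ≤ L.smr.1 ∧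
      (Module.finrank F ↥(P ⊓ L.grade 1) : ℤ) ≤ L.smr.2 := by
  obtain ⟨γ, hγ, hγc⟩ := L.exists_functional_eq_one hc h0
  -- The conditions are counted on `P ⊓ ker γ`, a complement of `F c` in `P`, since `ω c c = 0`
  -- holds for every skew form. The missing even dimension is returned by `L.derived` in the formula
  -- for the rank.
  have key : ∀ i, Module.finrank F (L.cocycles i) +
      Module.finrank F ↥(P ⊓ L.grade i ⊓ LinearMap.ker γ) ≤
      Module.finrank F (L.skewForms i) := by
    intro i
    obtain ⟨S, hS, hdim⟩ := finrank_skewForms_eq hc hγ hγc (i := i)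
      (Q := P ⊓ L.grade i ⊓ LinearMap.ker γ) (inf_le_left.trans inf_le_right) inf_le_right
    rw [← hdim]
    refine Nat.add_le_add_right (Submodule.finrank_mono fun ω hω => ?_) _
    exact (hS ω).mpr ⟨hω.1, fun z hz => hP i ω hω z hz.1.1 hz.1.2⟩
  have k0 := key 0
  have k1 := key 1
  have e0 := finrank_inf_ker_add_one (U := P ⊓ L.grade 0) ⟨hcP, hc⟩ hγc
  have e1 : P ⊓ L.grade 1 ⊓ LinearMap.ker γ = P ⊓ L.grade 1 :=
    inf_eq_left.mpr fun x hx => hγ _ _ hx.2 one_ne_zero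
  rw [e1] at k1
  rw [smr_eq, finrank_derived_zero_of_even hc h0 hder, finrank_derived_one_of_even hc hder]
  constructor
  · dsimp only; push_cast; omega
  · dsimp only; push_cast; omega

/-- If moreover every skew form that pairs `c` trivially with `P` is a cocycle, the
super-multiplier-rank is the superdimension of `P`. -/
theorem smr_eq_sdimSub (hc : c ∈ L.grade 0) (h0 : c ≠ 0) (hder : L.derived = F ∙ c) (hcP : c ∈ P)
    (hP : ∀ i, ∀ ω ∈ L.cocycles i, ∀ z ∈ P, z ∈ L.grade i → ω c z = 0)
    (hgr : ∀ i, ∀ z ∈ P, L.proj i z ∈ P)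
    (hP' : ∀ i, ∀ ω ∈ L.skewForms i, (∀ z ∈ P, ω c z = 0) → ω ∈ L.cocycles i) :
    L.smr = ((Module.finrank F ↥(P ⊓ L.grade 0) : ℤ), (Module.finrank F ↥(P ⊓ L.grade 1) : ℤ)) := by
  obtain ⟨γ, hγ, hγc⟩ := L.exists_functional_eq_one hc h0
  have key : ∀ i, Module.finrank F (L.cocycles i) +
      Module.finrank F ↥(P ⊓ L.grade i ⊓ LinearMap.ker γ) =
      Module.finrank F (L.skewForms i) := by
    intro i
    obtain ⟨S, hS, hdim⟩ := finrank_skewForms_eq hc hγ hγc (i := i)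
      (Q := P ⊓ L.grade i ⊓ LinearMap.ker γ) (inf_le_left.trans inf_le_right) inf_le_right
    have : L.cocycles i = S := by
      ext ω
      rw [hS]
      refine ⟨fun hω => ⟨hω.1, fun z hz => hP i ω hω z hz.1.1 hz.1.2⟩, fun ⟨hω, h⟩ => ?_⟩
      -- Vanishing on `P ⊓ ker γ` in parity `i` spreads to all of `P`: the `c`-component contributes
      -- `ω c c = 0`, and the other parity vanishes because `ω` has parity `i`.
      have hself := skewForm_self_eq_zero hω hc
      have hhom : ∀ j, ∀ z ∈ P, z ∈ L.grade j → ω c z = 0 := by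
        intro j z hz hzj
        by_cases hj : j = i
        · subst hj
          rcases zmod_two_cases j with rfl | rfl
          · have := h (z - γ z • c) ⟨⟨sub_mem hz (P.smul_mem _ hcP),
              sub_mem hzj (Submodule.smul_mem _ _ hc)⟩, by
                rw [SetLike.mem_coe, LinearMap.mem_ker, map_sub, map_smul, hγc, smul_eq_mul,
                  mul_one, sub_self]⟩
            rwa [map_sub, map_smul, hself, smul_zero, sub_zero] at this
          · exact h z ⟨⟨hz, hzj⟩, hγ _ _ hzj one_ne_zero⟩
        · exact (hω 0 j c z hc hzj).2 (by rwa [zero_add])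
      refine hP' i ω hω fun z hz => ?_
      rw [← L.proj_add_proj z, map_add, hhom 0 _ (hgr 0 z hz) (L.proj_mem 0 z),
        hhom 1 _ (hgr 1 z hz) (L.proj_mem 1 z), add_zero]
    rw [this, hdim]
  have k0 := key 0
  have k1 := key 1
  have e0 := finrank_inf_ker_add_one (U := P ⊓ L.grade 0) ⟨hcP, hc⟩ hγc
  have e1 : P ⊓ L.grade 1 ⊓ LinearMap.ker γ = P ⊓ L.grade 1 :=
    inf_eq_left.mpr fun x hx => hγ _ _ hx.2 one_ne_zero
  rw [e1] at k1
  rw [smr_eq, finrank_derived_zero_of_even hc h0 hder, finrank_derived_one_of_even hc hder]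
  refine Prod.ext ?_ ?_
  · dsimp only; push_cast; omega
  · dsimp only; push_cast; omega

end EvenDerived

theorem derived_eq_span (L : LieSuperalgebra F V) {c : V}
    (h : ∀ i j x y, x ∈ L.grade i → y ∈ L.grade j → L.bracket x y ∈ F ∙ c)
    (hc : c ∈ L.derived) : L.derived = F ∙ c :=
  le_antisymm (L.derived_le h) ((Submodule.span_singleton_le_iff_mem _ _).mpr hc)

theorem derived_eq_span_of_mem {L : LieSuperalgebra F V} {c d : V} (hder : L.derived = F ∙ c)
    (hd : d ∈ L.derived) (hd0 : d ≠ 0) : L.derived = F ∙ d := by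
  refine le_antisymm ?_ ((Submodule.span_singleton_le_iff_mem _ _).mpr hd)
  rw [hder, Submodule.mem_span_singleton] at hd
  obtain ⟨t, rfl⟩ := hd
  rw [hder, Submodule.span_singleton_le_iff_mem]
  have ht : t ≠ 0 := by
    rintro rfl
    exact hd0 (zero_smul _ _)
  exact Submodule.mem_span_singleton.mpr ⟨t⁻¹, inv_smul_smul₀ ht c⟩

theorem skewForm_even_swap {L : LieSuperalgebra F V} {i : ZMod 2} {ω : V →ₗ[F] V →ₗ[F] F}
    (hω : ω ∈ L.skewForms i) {c : V} (hc : c ∈ L.grade 0) (x : V) : ω x c = -ω c x := by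
  induction x using L.homogeneous_induction with
  | hom j x hx => rw [(hω j 0 x c hx hc).1, sign_zero_right, one_mul]
  | add x y hx hy => rw [map_add, LinearMap.add_apply, hx, hy, map_add]; ring

theorem bracket_even_swap {L : LieSuperalgebra F V} {c : V} (hc : c ∈ L.grade 0) (x : V) :
    L.bracket x c = -L.bracket c x := by
  induction x using L.homogeneous_induction with
  | hom j x hx => rw [L.skew hx hc, sign_zero_right, one_smul]
  | add x y hx hy => rw [map_add, LinearMap.add_apply, hx, hy, map_add]; abel

theorem bracket_self_eq_zero [CharZero F] {L : LieSuperalgebra F V} {x : V}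
    (hx : x ∈ L.grade 0) : L.bracket x x = 0 := by
  have e := eq_neg_iff_add_eq_zero.mp (bracket_even_swap hx x)
  rw [← two_smul F] at e
  exact (smul_eq_zero.mp e).resolve_left two_ne_zero

/-! ### Sums of `H(1, 0)` and an abelian superalgebra: coordinates and rank -/

/-- Coordinates exhibiting `L` as the sum of `H(1, 0)` and an abelian superalgebra: the bracket is
`[x, y] = (α x β y - β x α y) c`. -/
structure HeisenbergCoords (L : LieSuperalgebra F V) where
  c : V
  u : V
  v : V
  α : V →ₗ[F] F
  β : V →ₗ[F] F
  c_mem : c ∈ L.grade 0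
  u_mem : u ∈ L.grade 0
  v_mem : v ∈ L.grade 0
  c_ne : c ≠ 0
  α_hom : L.IsHomFunctional 0 α
  β_hom : L.IsHomFunctional 0 β
  α_c : α c = 0
  β_c : β c = 0
  α_u : α u = 1
  β_u : β u = 0
  α_v : α v = 0
  β_v : β v = 1
  bracket_eq : ∀ x y, L.bracket x y = (α x * β y - β x * α y) • c

namespace HeisenbergCoords

variable {L : LieSuperalgebra F V}

/-- The common kernel of the two coordinates. -/
def perp (D : HeisenbergCoords L) : Submodule F V := LinearMap.ker D.α ⊓ LinearMap.ker D.β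

theorem mem_perp (D : HeisenbergCoords L) {x : V} : x ∈ D.perp ↔ D.α x = 0 ∧ D.β x = 0 := Iff.rfl

theorem c_mem_perp (D : HeisenbergCoords L) : D.c ∈ D.perp := ⟨D.α_c, D.β_c⟩

theorem bracket_u_v (D : HeisenbergCoords L) : L.bracket D.u D.v = D.c := by
  rw [D.bracket_eq, D.α_u, D.β_v, D.β_u, D.α_v]
  simp

theorem derived_eq (D : HeisenbergCoords L) : L.derived = F ∙ D.c := by
  refine L.derived_eq_span (fun i j x y _ _ => ?_) ?_
  · rw [D.bracket_eq]
    exact Submodule.smul_mem _ _ (Submodule.mem_span_singleton_self _)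
  · rw [← D.bracket_u_v]
    exact L.bracket_mem_derived _ _

theorem odd_le_perp (D : HeisenbergCoords L) : L.grade 1 ≤ D.perp := fun _ hx =>
  ⟨D.α_hom _ _ hx one_ne_zero, D.β_hom _ _ hx one_ne_zero⟩

theorem proj_mem_perp (D : HeisenbergCoords L) (i : ZMod 2) {z : V} (hz : z ∈ D.perp) :
    L.proj i z ∈ D.perp := by
  have h1 : L.proj 1 z ∈ D.perp := D.odd_le_perp (L.proj_mem 1 z)
  rcases zmod_two_cases i with rfl | rfl
  · rw [← L.proj_add_proj z] at hz
    exact (Submodule.add_mem_iff_left _ h1).mp hz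
  · exact h1

theorem sub_mem_perp (D : HeisenbergCoords L) (x : V) :
    x - D.α x • D.u - D.β x • D.v ∈ D.perp := by
  rw [mem_perp]
  simp [D.α_u, D.α_v, D.β_u, D.β_v]

/-- A vector of `D.perp` commutes with `u` and `v`, so the cocycle identity for `u, v, z` forces `ω
c z = 0`. Conversely, if `ω c` kills `D.perp` it is a combination of `α` and `β`, and the cocycle
identity becomes the vanishing of an alternating 3-form in two functionals. -/
theorem smr_eq [CharZero F] [FiniteDimensional F V] (D : HeisenbergCoords L) :
    L.smr = ((Module.finrank F ↥(D.perp ⊓ L.grade 0) : ℤ),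
      (Module.finrank F ↥(D.perp ⊓ L.grade 1) : ℤ)) := by
  have : Nontrivial V := ⟨D.c, 0, D.c_ne⟩
  refine smr_eq_sdimSub D.c_mem D.c_ne D.derived_eq D.c_mem_perp (fun i ω hω z hz _ => ?_)
    (fun i z hz => D.proj_mem_perp i hz) fun i ω hω h => ⟨hω, fun a b x y z hx hy => ?_⟩
  · have e := hω.2 0 0 D.u D.v z D.u_mem D.v_mem
    rw [D.bracket_u_v, D.bracket_eq, D.bracket_eq, hz.1, hz.2] at e
    simpa using e.symm
  · have hl : ∀ x, ω D.c x = D.α x * ω D.c D.u + D.β x * ω D.c D.v := fun x => by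
      have := h _ (D.sub_mem_perp x)
      rw [map_sub, map_sub, map_smul, map_smul, smul_eq_mul, smul_eq_mul] at this
      linear_combination this
    rw [D.bracket_eq, D.bracket_eq, D.bracket_eq, map_smul, map_smul, map_smul,
      LinearMap.smul_apply, skewForm_even_swap hω D.c_mem, skewForm_even_swap hω D.c_mem,
      smul_eq_mul, smul_eq_mul, smul_eq_mul, hl x, hl y, hl z]
    rcases zmod_two_cases a with rfl | rfl
    · rcases zmod_two_cases b with rfl | rfl
      · rw [sign_zero_left]
        ring
      · rw [D.α_hom _ _ hy one_ne_zero, D.β_hom _ _ hy one_ne_zero]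
        ring
    · rw [D.α_hom _ _ hx one_ne_zero, D.β_hom _ _ hx one_ne_zero]
      ring

end HeisenbergCoords

/-! ### Derived subalgebra spanned by an odd square -/

/-- If `[w,z] = 0`, the cocycle identity for `w, w, z` gives the claim. For `z = w` it reads `3
ω([w,w], w) = 0`. In general `[w,z] = t [w,w]`, so `z - t w` commutes with `w`. -/
theorem cocycle_square_eq_zero [CharZero F] {L : LieSuperalgebra F V} {w : V}
    (hw : w ∈ L.grade 1) (hder : L.derived = F ∙ L.bracket w w)
    {i : ZMod 2} {ω : V →ₗ[F] V →ₗ[F] F} (hω : ω ∈ L.cocycles i) (z : V) :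
    ω (L.bracket w w) z = 0 := by
  have hc : L.bracket w w ∈ L.grade 0 := L.bracket_mem hw hw
  have hperp : ∀ z, L.bracket w z = 0 → ω (L.bracket w w) z = 0 := fun z h => by
    have e := hω.2 1 1 w w z hw hw
    rw [h, map_zero] at e
    simpa using e.symm
  obtain ⟨t, ht⟩ := Submodule.mem_span_singleton.mp (hder ▸ L.bracket_mem_derived w z)
  have h3 : ω (L.bracket w w) w = 0 := by
    have e := hω.2 1 1 w w w hw hw
    rw [skewForm_even_swap hω.1 hc, sign_one_one] at e
    have : (3 : F) * ω (L.bracket w w) w = 0 := by linear_combination -e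
    simpa using this
  have := hperp (z - t • w) (by rw [map_sub, map_smul, ht, sub_self])
  rwa [map_sub, map_smul, h3, smul_zero, sub_zero] at this

/-- If the derived subalgebra is spanned by `[w, w]` with `w` odd, then the super-multiplier-rank
is the superdimension. -/
theorem smr_eq_sdim_of_odd_square [CharZero F] [FiniteDimensional F V] {L : LieSuperalgebra F V}
    {w : V} (hw : w ∈ L.grade 1) (hw0 : L.bracket w w ≠ 0)
    (hder : L.derived = F ∙ L.bracket w w) :
    L.smr = ((Module.finrank F (L.grade 0) : ℤ), (Module.finrank F (L.grade 1) : ℤ)) := by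
  have : Nontrivial V := ⟨_, 0, hw0⟩
  have hc : L.bracket w w ∈ L.grade 0 := L.bracket_mem hw hw
  have h := smr_eq_sdimSub (P := ⊤) hc hw0 hder trivial
    (fun i ω hω z _ _ => cocycle_square_eq_zero hw hder hω z) (fun _ _ _ => trivial)
    fun i ω hω h => ⟨hω, fun a b x y z hx hy => ?_⟩
  · rwa [top_inf_eq, top_inf_eq] at h
  · have hl : ∀ x y z, ω (L.bracket x y) z = 0 := fun x y z => by
      obtain ⟨t, ht⟩ := Submodule.mem_span_singleton.mp (hder ▸ L.bracket_mem_derived x y)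
      rw [← ht, map_smul, LinearMap.smul_apply, h z trivial, smul_zero]
    have hr : ∀ x y z, ω z (L.bracket x y) = 0 := fun x y z => by
      obtain ⟨t, ht⟩ := Submodule.mem_span_singleton.mp (hder ▸ L.bracket_mem_derived x y)
      rw [← ht, map_smul, skewForm_even_swap hω hc, h z trivial, neg_zero, smul_zero]
    rw [hl, hr, hr, mul_zero, add_zero]

/-! ### Derived subalgebra an even line, no odd squares -/

/-- The brackets of odd vectors vanish as soon as all odd squares do. -/
theorem bracket_odd_eq_zero [CharZero F] {L : LieSuperalgebra F V}
    (h : ∀ w ∈ L.grade 1, L.bracket w w = 0) {x y : V} (hx : x ∈ L.grade 1)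
    (hy : y ∈ L.grade 1) : L.bracket x y = 0 := by
  have e := h (x + y) (add_mem hx hy)
  rw [map_add, map_add, LinearMap.add_apply, LinearMap.add_apply, h x hx, h y hy, L.skew hy hx,
    sign_one_one, neg_one_smul, neg_neg, zero_add, add_zero, ← two_smul F] at e
  exact (smul_eq_zero.mp e).resolve_left two_ne_zero

/-- If the derived subalgebra is an even central line, all odd squares vanish, and the even part of
the super-multiplier-rank is at most two, then `L` is the sum of `H(1, 0)` and an abelian
superalgebra. -/
theorem nonempty_heisenbergCoords [CharZero F] [FiniteDimensional F V] {L : LieSuperalgebra F V}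
    (hab : ¬ L.IsAbelian) {c₀ : V} (hc₀ : c₀ ∈ L.grade 0) (hcc₀ : c₀ ∈ L.center)
    (hder₀ : L.derived = F ∙ c₀) (hsq : ∀ w ∈ L.grade 1, L.bracket w w = 0)
    (hsmr : L.smr.1 ≤ 2) : Nonempty (HeisenbergCoords L) := by
  have hev₀ : L.derived ≤ L.grade 0 :=
    hder₀.le.trans ((Submodule.span_singleton_le_iff_mem _ _).mpr hc₀)
  -- Even-odd brackets are odd inside an even line, and odd-odd brackets vanish by polarization; the
  -- bracket lives on the even part.
  have hmix : ∀ {j x y}, x ∈ L.grade 1 → y ∈ L.grade j → L.bracket x y = 0 := by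
    intro j x y hx hy
    rcases zmod_two_cases j with rfl | rfl
    · exact L.eq_zero_of_mem_grade zero_ne_one (L.bracket_mem hx hy)
        (hev₀ (L.bracket_mem_derived x y))
    · exact bracket_odd_eq_zero hsq hx hy
  obtain ⟨u, v, hu, hv, huv⟩ : ∃ u v, u ∈ L.grade 0 ∧ v ∈ L.grade 0 ∧ L.bracket u v ≠ 0 := by
    obtain ⟨a, b, x, y, hx, hy, hxy⟩ := exists_homogeneous_bracket_ne_zero hab
    rcases zmod_two_cases a with rfl | rfl
    · rcases zmod_two_cases b with rfl | rfl
      · exact ⟨x, y, hx, hy, hxy⟩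
      · exact absurd (L.bracket_eq_zero_comm hy hx (hmix hy hx)) hxy
    · exact absurd (hmix hx hy) hxy
  obtain ⟨c, hcdef⟩ : ∃ c, L.bracket u v = c := ⟨_, rfl⟩
  have hcd : c ∈ L.derived := hcdef ▸ L.bracket_mem_derived u v
  have hc : c ∈ L.grade 0 := hev₀ hcd
  rw [hcdef] at huv
  have hder : L.derived = F ∙ c := derived_eq_span_of_mem hder₀ hcd huv
  have hcc : c ∈ L.center := (Submodule.span_singleton_le_iff_mem _ _).mpr hcc₀ (hder₀ ▸ hcd)
  have : Nontrivial V := ⟨_, 0, huv⟩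
  obtain ⟨γ, hγ, hγc⟩ := L.exists_functional_eq_one hc huv
  have hB : ∀ x y, L.bracket x y = γ (L.bracket x y) • c := fun x y => by
    obtain ⟨t, ht⟩ := Submodule.mem_span_singleton.mp (hder ▸ L.bracket_mem_derived x y)
    rw [← ht, map_smul, hγc, smul_eq_mul, mul_one]
  -- `α` and `β` read off the `u`- and `v`-coordinates, through `[x,v] = α(x) c` and `[u,x] = β(x)
  -- c`.
  let α : V →ₗ[F] F := γ ∘ₗ L.bracket.flip v
  let β : V →ₗ[F] F := γ ∘ₗ L.bracket u
  have hα : ∀ x, L.bracket x v = α x • c := fun x => hB x v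
  have hβ : ∀ x, L.bracket u x = β x • c := fun x => hB u x
  have hα' : ∀ x, α x = γ (L.bracket x v) := fun _ => rfl
  have hβ' : ∀ x, β x = γ (L.bracket u x) := fun _ => rfl
  have huu := bracket_self_eq_zero hu
  have hvv := bracket_self_eq_zero hv
  have hαu : α u = 1 := by rw [hα', hcdef, hγc]
  have hβv : β v = 1 := by rw [hβ', hcdef, hγc]
  have hαv : α v = 0 := by rw [hα', hvv, map_zero]
  have hβu : β u = 0 := by rw [hβ', huu, map_zero]
  have hαc : α c = 0 := by rw [hα', L.bracket_eq_zero_of_mem_center hcc, map_zero]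
  have hβc : β c = 0 := by rw [hβ', L.bracket_center hcc, map_zero]
  have hαh : L.IsHomFunctional 0 α := fun j x hx hj => by
    obtain rfl : j = 1 := zmod_two_eq_add_one hj
    rw [hα', hmix hx hv, map_zero]
  have hβh : L.IsHomFunctional 0 β := fun j x hx hj => by
    obtain rfl : j = 1 := zmod_two_eq_add_one hj
    rw [hβ', L.bracket_eq_zero_comm hx hu (hmix hx hu), map_zero]
  have hP := sdimSub_le_smr (P := LinearMap.ker α ⊓ LinearMap.ker β) hc huv hder ⟨hαc, hβc⟩
    fun i ω hω z hz hzi => by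
      have e := hω.2 0 0 u v z hu hv
      have hz2 : L.bracket u z = 0 := by rw [hβ, LinearMap.mem_ker.mp hz.2, zero_smul]
      have hz1 : L.bracket v z = 0 :=
        L.bracket_eq_zero_comm hzi hv (by rw [hα, LinearMap.mem_ker.mp hz.1, zero_smul])
      rw [hz1, hz2, hcdef] at e
      simpa using e.symm
  have hsmall : Module.finrank F ↥(LinearMap.ker α ⊓ LinearMap.ker β ⊓ L.grade 0) ≤ 2 := by
    have := hP.1.trans hsmr
    exact_mod_cast this
  -- If `[x,y] ≠ 0`, bracketing a linear relation among `c, x, y` with `y` and with `x` shows that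
  -- they are independent, too many for an even part of dimension at most 2.
  have hcomm : ∀ x y, α x = 0 → β x = 0 → α y = 0 → β y = 0 → x ∈ L.grade 0 → y ∈ L.grade 0 →
      L.bracket x y = 0 := by
    intro x y hx1 hx2 hy1 hy2 hx hy
    by_contra hne
    have hli : LinearIndependent F ![(⟨c, ⟨hαc, hβc⟩, hc⟩ :
        ↥(LinearMap.ker α ⊓ LinearMap.ker β ⊓ L.grade 0)), ⟨x, ⟨hx1, hx2⟩, hx⟩,
        ⟨y, ⟨hy1, hy2⟩, hy⟩] := by
      refine Fintype.linearIndependent_iff.mpr fun g hg => ?_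
      rw [Fin.sum_univ_three] at hg
      replace hg : g 0 • c + g 1 • x + g 2 • y = 0 := congrArg Subtype.val hg
      have e1 : g 1 • L.bracket x y = 0 := by
        have := congrArg (fun z => L.bracket z y) hg
        simpa [L.bracket_eq_zero_of_mem_center hcc, bracket_self_eq_zero hy] using this
      have e2 : g 2 • L.bracket x y = 0 := by
        have := congrArg (L.bracket x) hg
        simpa [L.bracket_center hcc, bracket_self_eq_zero hx] using this
      have g1 := (smul_eq_zero.mp e1).resolve_right hne
      have g2 := (smul_eq_zero.mp e2).resolve_right hne
      rw [g1, g2, zero_smul, zero_smul, add_zero, add_zero] at hg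
      have g0 := (smul_eq_zero.mp hg).resolve_right huv
      intro i
      fin_cases i
      · exact g0
      · exact g1
      · exact g2
    have := hli.fintype_card_le_finrank
    rw [Fintype.card_fin] at this
    omega
  refine ⟨⟨c, u, v, α, β, hc, hu, hv, huv, hαh, hβh, hαc, hβc, hαu, hβu, hαv, hβv, ?_⟩⟩
  have hperp : ∀ x y, α x = 0 → β x = 0 → α y = 0 → β y = 0 → L.bracket x y = 0 := by
    have heven : ∀ {f : V →ₗ[F] F}, L.IsHomFunctional 0 f → ∀ x, f x = 0 →
        f (L.proj 0 x) = 0 := fun {f} hf x hx => by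
      rwa [← L.proj_add_proj x, map_add, hf _ _ (L.proj_mem 1 x) one_ne_zero, add_zero] at hx
    intro x y hx1 hx2 hy1 hy2
    rw [← L.proj_add_proj x, ← L.proj_add_proj y, map_add, map_add, LinearMap.add_apply,
      LinearMap.add_apply, hmix (L.proj_mem 1 x) (L.proj_mem 0 y),
      hmix (L.proj_mem 1 x) (L.proj_mem 1 y),
      L.bracket_eq_zero_comm (L.proj_mem 1 y) (L.proj_mem 0 x)
        (hmix (L.proj_mem 1 y) (L.proj_mem 0 x)),
      hcomm _ _ (heven hαh x hx1) (heven hβh x hx2) (heven hαh y hy1) (heven hβh y hy2)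
        (L.proj_mem 0 x) (L.proj_mem 0 y)]
    simp
  have hv' : ∀ x, L.bracket v x = -(α x • c) := fun x => by
    rw [← hα, bracket_even_swap hv, neg_neg]
  have hu' : ∀ x, L.bracket x u = -(β x • c) := fun x => by
    rw [← hβ, bracket_even_swap hu]
  intro x y
  -- Removing the `u`- and `v`-components puts both vectors in the common kernel; expanding their
  -- zero bracket yields the coordinate formula.
  have e := hperp (x - α x • u - β x • v) (y - α y • u - β y • v) (by simp [hαu, hαv])
    (by simp [hβu, hβv]) (by simp [hαu, hαv]) (by simp [hβu, hβv])
  simp only [map_sub, map_smul, LinearMap.sub_apply, LinearMap.smul_apply, hα, hβ, hu', hv', hαu,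
    hαv, hβu, hβv] at e
  rw [← sub_eq_zero, ← e]
  module

/-! ### Recognition of the model superalgebras -/

theorem Hom.mem_grade_of_injective {G : LieSuperalgebra F V} {H : LieSuperalgebra F W}
    (f : Hom G H) (hf : Function.Injective f.toLinearMap) {i : ZMod 2} {x : V}
    (h : f.toLinearMap x ∈ H.grade i) : x ∈ G.grade i := by
  have : G.proj i x = x := hf (by rw [f.map_proj, H.proj_of_mem h])
  rw [← this]
  exact G.proj_mem i x

namespace HeisenbergCoords

variable {L : LieSuperalgebra F V}

/-- `α`, `β` and `γ` give the Heisenberg coordinates. A complement of `F c` in the even part of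
`D.perp`, together with the odd part, gives the abelian summand; hence `m + 1` rather than `m`. -/
theorem isomorphic [FiniteDimensional F V] (D : HeisenbergCoords L) {m n : ℕ}
    (hm : Module.finrank F ↥(D.perp ⊓ L.grade 0) = m + 1)
    (hn : Module.finrank F ↥(D.perp ⊓ L.grade 1) = n) :
    L.Isomorphic ((heisenberg F 1 0).directSum (ab F m n)) := by
  obtain ⟨γ, hγ, hγc⟩ := L.exists_functional_eq_one D.c_mem D.c_ne
  have hQ := finrank_inf_ker_add_one (U := D.perp ⊓ L.grade 0) ⟨D.c_mem_perp, D.c_mem⟩ hγc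
  obtain ⟨r₀, hr₀, hh₀⟩ := L.exists_retraction (i := 0)
    (U := D.perp ⊓ L.grade 0 ⊓ LinearMap.ker γ) (inf_le_left.trans inf_le_right)
  obtain ⟨r₁, hr₁, hh₁⟩ := L.exists_retraction (i := 1) (U := D.perp ⊓ L.grade 1) inf_le_right
  let e₀ : ↥(D.perp ⊓ L.grade 0 ⊓ LinearMap.ker γ) ≃ₗ[F] (Fin m → F) :=
    (Module.finBasisOfFinrankEq F _ (by omega)).equivFun
  let e₁ : ↥(D.perp ⊓ L.grade 1) ≃ₗ[F] (Fin n → F) :=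
    (Module.finBasisOfFinrankEq F _ hn).equivFun
  let η : V →ₗ[F] (Fin m → F) :=
    e₀.toLinearMap ∘ₗ r₀ ∘ₗ (LinearMap.id - γ.smulRight D.c)
  let ζ : V →ₗ[F] (Fin n → F) := e₁.toLinearMap ∘ₗ r₁
  have hη : ∀ x, η x = e₀ (r₀ (x - γ x • D.c)) := fun _ => rfl
  have hζ : ∀ x, ζ x = e₁ (r₁ x) := fun _ => rfl
  have hηc : η D.c = 0 := by rw [hη, hγc, one_smul, sub_self, map_zero, map_zero]
  have hζ0 : ∀ x, x ∈ L.grade 0 → ζ x = 0 := fun x hx => by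
    rw [hζ, hh₁ _ _ hx zero_ne_one, map_zero]
  have hη1 : ∀ x, x ∈ L.grade 1 → η x = 0 := fun x hx => by
    rw [hη, hγ _ _ hx one_ne_zero, zero_smul, sub_zero, hh₀ _ _ hx one_ne_zero, map_zero]
  let φ : V →ₗ[F] ((((Fin 1 → F) × (Fin 1 → F) × F) × (Fin 0 → F)) ×
      ((Fin m → F) × (Fin n → F))) :=
    (((LinearMap.pi fun _ => D.α).prod ((LinearMap.pi fun _ => D.β).prod γ)).prod 0).prod
      (η.prod ζ)
  have hφ : ∀ x, φ x = (((fun _ => D.α x, fun _ => D.β x, γ x), 0), (η x, ζ x)) := fun _ => rfl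
  refine ⟨⟨φ, fun {i x} hx => ?_, fun x y => ?_⟩, ?_, ?_⟩
  · rw [hφ]
    rcases zmod_two_cases i with rfl | rfl
    · exact ⟨mem_prodGrade_zero.mpr rfl, mem_prodGrade_zero.mpr (hζ0 x hx)⟩
    · refine ⟨mem_prodGrade_one.mpr ?_, mem_prodGrade_one.mpr (hη1 x hx)⟩
      simp only [D.α_hom _ _ hx one_ne_zero, D.β_hom _ _ hx one_ne_zero, hγ _ _ hx one_ne_zero]
      rfl
  · change φ _ = (heisenbergBracket F 1 0 (φ x).1 (φ y).1, 0)
    rw [heisenbergBracket_apply, D.bracket_eq, map_smul, hφ, hφ, hφ, D.α_c, D.β_c, hγc, hηc,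
      hζ0 _ D.c_mem]
    refine Prod.ext (Prod.ext (Prod.ext ?_ (Prod.ext ?_ ?_)) ?_) (Prod.ext ?_ ?_)
    · ext; simp
    · ext; simp
    · simp
    · simp
    · simp
    · simp
  · refine (injective_iff_map_eq_zero φ).mpr fun x hx => ?_
    rw [hφ] at hx
    simp only [Prod.mk_eq_zero] at hx
    obtain ⟨⟨⟨hα, hβ, hγx⟩, -⟩, hηx, hζx⟩ := hx
    have hxP : x ∈ D.perp := ⟨congrFun hα 0, congrFun hβ 0⟩
    have h1 : L.proj 1 x = 0 := by
      have h2 : r₁ (L.proj 1 x) = 0 := by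
        have : ζ x = ζ (L.proj 1 x) := by
          conv_lhs => rw [← L.proj_add_proj x, map_add, hζ0 _ (L.proj_mem 0 x), zero_add]
        rw [hζx, hζ] at this
        exact e₁.map_eq_zero_iff.mp this.symm
      have h3 := hr₁ ⟨L.proj 1 x, D.proj_mem_perp 1 hxP, L.proj_mem 1 x⟩
      rw [h2] at h3
      exact (congrArg Subtype.val h3).symm
    have hx0 : x ∈ L.grade 0 := by
      rw [← L.proj_add_proj x, h1, add_zero]
      exact L.proj_mem 0 x
    rw [hη, hγx, zero_smul, sub_zero, e₀.map_eq_zero_iff, hr₀ ⟨x, ⟨hxP, hx0⟩, hγx⟩] at hηx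
    exact congrArg Subtype.val hηx
  · rintro ⟨⟨⟨a, b, g⟩, z⟩, y, t⟩
    let x₀ := a 0 • D.u + b 0 • D.v
    have hx₀ : x₀ ∈ L.grade 0 :=
      add_mem (Submodule.smul_mem _ _ D.u_mem) (Submodule.smul_mem _ _ D.v_mem)
    -- `u` and `v` may have nonzero `η`- and `γ`-coordinates, so the preimage has to correct for
    -- those of `x₀`.
    let q := e₀.symm (y - η x₀)
    let s := e₁.symm t
    have hηq : η q = y - η x₀ := by
      rw [hη, LinearMap.mem_ker.mp q.2.2, zero_smul, sub_zero, hr₀, e₀.apply_symm_apply]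
    have hζs : ζ s = t := by rw [hζ, hr₁, e₁.apply_symm_apply]
    have hαx : D.α x₀ = a 0 := by simp [x₀, D.α_u, D.α_v]
    have hβx : D.β x₀ = b 0 := by simp [x₀, D.β_u, D.β_v]
    refine ⟨x₀ + (g - γ x₀) • D.c + q + s, ?_⟩
    rw [hφ]
    refine Prod.ext (Prod.ext (Prod.ext ?_ (Prod.ext ?_ ?_)) ?_) (Prod.ext ?_ ?_)
    · ext i
      simp only [map_add, map_smul, hαx, D.α_c, (D.mem_perp.mp q.2.1.1).1,
        (D.mem_perp.mp s.2.1).1, smul_zero, add_zero]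
      rw [Subsingleton.elim i 0]
    · ext i
      simp only [map_add, map_smul, hβx, D.β_c, (D.mem_perp.mp q.2.1.1).2,
        (D.mem_perp.mp s.2.1).2, smul_zero, add_zero]
      rw [Subsingleton.elim i 0]
    · simp only [map_add, map_smul, hγc, LinearMap.mem_ker.mp q.2.2,
        hγ _ _ s.2.2 one_ne_zero, smul_eq_mul]
      ring
    · exact Subsingleton.elim _ _
    · simp only [map_add, map_smul, hηc, hηq, hη1 _ s.2.2, smul_zero]
      abel
    · simp only [map_add, map_smul, hζ0 _ hx₀, hζ0 _ D.c_mem, hζ0 _ q.2.1.2, hζs, smul_zero,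
        zero_add]

end HeisenbergCoords

/-- Pulling the coordinates back along the isomorphism allows the rank to be computed on `L` itself,
so invariance of `smr` under isomorphism is not needed. -/
theorem Isomorphic.exists_heisenbergCoords {L : LieSuperalgebra F V} {m n : ℕ}
    (h : L.Isomorphic ((heisenberg F 1 0).directSum (ab F m n))) :
    ∃ D : HeisenbergCoords L, Module.finrank F ↥(D.perp ⊓ L.grade 0) = m + 1 ∧
      Module.finrank F ↥(D.perp ⊓ L.grade 1) = n := by
  obtain ⟨f, hinj, hsurj⟩ := h
  let φ : V ≃ₗ[F] (((Fin 1 → F) × (Fin 1 → F) × F) × (Fin 0 → F)) ×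
      ((Fin m → F) × (Fin n → F)) := LinearEquiv.ofBijective f.toLinearMap ⟨hinj, hsurj⟩
  have hφf : ∀ x, φ x = f.toLinearMap x := fun _ => rfl
  have hφ : ∀ e, f.toLinearMap (φ.symm e) = e := fun e => φ.apply_symm_apply e
  have heven : ∀ e, e.1.2 = 0 → e.2.2 = 0 → φ.symm e ∈ L.grade 0 := fun e h1 h2 =>
    f.mem_grade_of_injective hinj (by
      rw [hφ]
      exact ⟨mem_prodGrade_zero.mpr h1, mem_prodGrade_zero.mpr h2⟩)
  have hodd : ∀ e, e.1.1 = 0 → e.2.1 = 0 → φ.symm e ∈ L.grade 1 := fun e h1 h2 =>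
    f.mem_grade_of_injective hinj (by
      rw [hφ]
      exact ⟨mem_prodGrade_one.mpr h1, mem_prodGrade_one.mpr h2⟩)
  have hg0 : ∀ x ∈ L.grade 0, (φ x).1.2 = 0 ∧ (φ x).2.2 = 0 := fun x hx =>
    ⟨mem_prodGrade_zero.mp (f.map_grade hx).1, mem_prodGrade_zero.mp (f.map_grade hx).2⟩
  have hg1 : ∀ x ∈ L.grade 1, (φ x).1.1 = 0 ∧ (φ x).2.1 = 0 := fun x hx =>
    ⟨mem_prodGrade_one.mp (f.map_grade hx).1, mem_prodGrade_one.mp (f.map_grade hx).2⟩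
  let α : V →ₗ[F] F := LinearMap.proj 0 ∘ₗ LinearMap.fst F _ _ ∘ₗ LinearMap.fst F _ _ ∘ₗ
    LinearMap.fst F _ _ ∘ₗ φ.toLinearMap
  let β : V →ₗ[F] F := LinearMap.proj 0 ∘ₗ LinearMap.fst F _ _ ∘ₗ LinearMap.snd F _ _ ∘ₗ
    LinearMap.fst F _ _ ∘ₗ LinearMap.fst F _ _ ∘ₗ φ.toLinearMap
  have hα : ∀ x, α x = (φ x).1.1.1 0 := fun _ => rfl
  have hβ : ∀ x, β x = (φ x).1.1.2.1 0 := fun _ => rfl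
  let D : HeisenbergCoords L :=
    { c := φ.symm (((0, 0, 1), 0), 0)
      u := φ.symm (((1, 0, 0), 0), 0)
      v := φ.symm (((0, 1, 0), 0), 0)
      α := α
      β := β
      c_mem := heven _ rfl rfl
      u_mem := heven _ rfl rfl
      v_mem := heven _ rfl rfl
      c_ne := fun h => by
        rw [LinearEquiv.map_eq_zero_iff] at h
        simp at h
      α_hom := fun j x hx hj => by
        obtain rfl : j = 1 := zmod_two_eq_add_one hj
        rw [hα, (hg1 x hx).1]; rfl
      β_hom := fun j x hx hj => by
        obtain rfl : j = 1 := zmod_two_eq_add_one hj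
        rw [hβ, (hg1 x hx).1]; rfl
      α_c := by rw [hα, φ.apply_symm_apply]; rfl
      β_c := by rw [hβ, φ.apply_symm_apply]; rfl
      α_u := by rw [hα, φ.apply_symm_apply]; rfl
      β_u := by rw [hβ, φ.apply_symm_apply]; rfl
      α_v := by rw [hα, φ.apply_symm_apply]; rfl
      β_v := by rw [hβ, φ.apply_symm_apply]; rfl
      bracket_eq := fun x y => by
        apply φ.injective
        rw [map_smul, φ.apply_symm_apply, hφf, f.map_bracket]
        change (heisenbergBracket F 1 0 (φ x).1 (φ y).1, 0) = _
        rw [heisenbergBracket_apply, hα, hβ, hα, hβ]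
        refine Prod.ext (Prod.ext (Prod.ext ?_ (Prod.ext ?_ ?_)) ?_) ?_ <;> simp }
  refine ⟨D, ?_, ?_⟩
  · have hp : ∀ x ∈ D.perp, (φ x).1.1.1 = 0 ∧ (φ x).1.1.2.1 = 0 := fun x hx =>
      ⟨funext fun i => by rw [Subsingleton.elim i 0]; exact hx.1,
        funext fun i => by rw [Subsingleton.elim i 0]; exact hx.2⟩
    let ψ : ↥(D.perp ⊓ L.grade 0) →ₗ[F] F × (Fin m → F) :=
      ((LinearMap.snd F _ _ ∘ₗ LinearMap.snd F _ _ ∘ₗ LinearMap.fst F _ _ ∘ₗ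
        LinearMap.fst F _ _).prod (LinearMap.fst F _ _ ∘ₗ LinearMap.snd F _ _)) ∘ₗ
        φ.toLinearMap ∘ₗ Submodule.subtype _
    have hψ : ∀ x, ψ x = ((φ x).1.1.2.2, (φ x).2.1) := fun _ => rfl
    have hbij : Function.Bijective ψ := by
      refine ⟨(injective_iff_map_eq_zero ψ).mpr fun x hx => ?_, fun y => ?_⟩
      · rw [hψ, Prod.mk_eq_zero] at hx
        refine Subtype.ext (φ.map_eq_zero_iff.mp ?_)
        refine Prod.ext (Prod.ext (Prod.ext (hp x x.2.1).1 (Prod.ext (hp x x.2.1).2 hx.1))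
          (hg0 x x.2.2).1) (Prod.ext hx.2 (hg0 x x.2.2).2)
      · refine ⟨⟨φ.symm (((0, 0, y.1), 0), (y.2, 0)), ⟨?_, ?_⟩, heven _ rfl rfl⟩, ?_⟩
        · change α _ = 0
          rw [hα, φ.apply_symm_apply]; rfl
        · change β _ = 0
          rw [hβ, φ.apply_symm_apply]; rfl
        · rw [hψ, φ.apply_symm_apply]
    rw [(LinearEquiv.ofBijective ψ hbij).finrank_eq, Module.finrank_prod, Module.finrank_self,
      Module.finrank_fin_fun, add_comm]
  · let ψ : ↥(D.perp ⊓ L.grade 1) →ₗ[F] (Fin n → F) :=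
      LinearMap.snd F _ _ ∘ₗ LinearMap.snd F _ _ ∘ₗ φ.toLinearMap ∘ₗ Submodule.subtype _
    have hψ : ∀ x, ψ x = (φ x).2.2 := fun _ => rfl
    have hbij : Function.Bijective ψ := by
      refine ⟨(injective_iff_map_eq_zero ψ).mpr fun x hx => ?_, fun y => ?_⟩
      · rw [hψ] at hx
        refine Subtype.ext (φ.map_eq_zero_iff.mp ?_)
        exact Prod.ext (Prod.ext (hg1 x x.2.2).1 (Subsingleton.elim _ _))
          (Prod.ext (hg1 x x.2.2).2 hx)
      · have hmem := hodd (0, (0, y)) rfl rfl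
        refine ⟨⟨φ.symm (0, (0, y)), D.odd_le_perp hmem, hmem⟩, ?_⟩
        rw [hψ, φ.apply_symm_apply]
    rw [(LinearEquiv.ofBijective ψ hbij).finrank_eq, Module.finrank_fin_fun]

/-- Recognition of `H(0, 1)`. -/
theorem isomorphic_heisenberg_zero_one_iff [CharZero F] {L : LieSuperalgebra F V} :
    L.Isomorphic (heisenberg F 0 1) ↔
      Module.finrank F (L.grade 0) = 1 ∧ Module.finrank F (L.grade 1) = 1 ∧
      ∃ w ∈ L.grade 1, L.bracket w w ≠ 0 ∧ L.derived = F ∙ L.bracket w w := by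
  constructor
  · rintro ⟨f, hinj, hsurj⟩
    let φ : V ≃ₗ[F] ((Fin 0 → F) × (Fin 0 → F) × F) × (Fin 1 → F) :=
      LinearEquiv.ofBijective f.toLinearMap ⟨hinj, hsurj⟩
    have hφ : ∀ e, f.toLinearMap (φ.symm e) = e := fun e => φ.apply_symm_apply e
    have hg0 : ∀ x ∈ L.grade 0, (φ x).2 = 0 := fun x hx => mem_prodGrade_zero.mp (f.map_grade hx)
    have hg1 : ∀ x ∈ L.grade 1, (φ x).1 = 0 := fun x hx => mem_prodGrade_one.mp (f.map_grade hx)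
    have heven : ∀ e, e.2 = 0 → φ.symm e ∈ L.grade 0 := fun e h =>
      f.mem_grade_of_injective hinj (by rw [hφ]; exact mem_prodGrade_zero.mpr h)
    have hodd : ∀ e, e.1 = 0 → φ.symm e ∈ L.grade 1 := fun e h =>
      f.mem_grade_of_injective hinj (by rw [hφ]; exact mem_prodGrade_one.mpr h)
    have hbr : ∀ x y, φ (L.bracket x y) = ((φ x).2 0 * (φ y).2 0) • ((0, 0, 1), 0) := by
      intro x y
      change f.toLinearMap _ = _
      rw [f.map_bracket]
      change heisenbergBracket F 0 1 (φ x) (φ y) = _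
      rw [heisenbergBracket_apply]
      refine Prod.ext (Prod.ext ?_ (Prod.ext ?_ ?_)) ?_ <;> simp
    have hww : φ (L.bracket (φ.symm (0, 1)) (φ.symm (0, 1))) = ((0, 0, 1), 0) := by
      rw [hbr, φ.apply_symm_apply]; simp
    refine ⟨?_, ?_, φ.symm (0, 1), hodd _ rfl, fun h => ?_, ?_⟩
    · refine finrank_eq_one (⟨φ.symm ((0, 0, 1), 0), heven _ rfl⟩ : L.grade 0) (fun h => ?_)
        fun x => ⟨(φ x).1.2.2, Subtype.ext (φ.injective ?_)⟩
      · have := congrArg Subtype.val h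
        rw [Submodule.coe_zero, LinearEquiv.map_eq_zero_iff] at this
        simp at this
      · change φ ((φ x).1.2.2 • φ.symm ((0, 0, 1), 0)) = φ x
        rw [map_smul, φ.apply_symm_apply]
        refine Prod.ext (Prod.ext (Subsingleton.elim _ _) (Prod.ext (Subsingleton.elim _ _) ?_)) ?_
        · simp
        · rw [hg0 x x.2]; simp
    · refine finrank_eq_one (⟨φ.symm (0, 1), hodd _ rfl⟩ : L.grade 1) (fun h => ?_)
        fun x => ⟨(φ x).2 0, Subtype.ext (φ.injective ?_)⟩
      · have := congrArg Subtype.val h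
        rw [Submodule.coe_zero, LinearEquiv.map_eq_zero_iff] at this
        simp at this
      · change φ ((φ x).2 0 • φ.symm (0, 1)) = φ x
        rw [map_smul, φ.apply_symm_apply]
        refine Prod.ext ?_ (funext fun i => ?_)
        · rw [hg1 x x.2]; simp
        · rw [Subsingleton.elim i 0]; simp
    · rw [h, map_zero] at hww
      exact zero_ne_one (congrArg (fun e => e.1.2.2) hww)
    · refine L.derived_eq_span (fun i j x y _ _ => ?_) (L.bracket_mem_derived _ _)
      refine Submodule.mem_span_singleton.mpr ⟨(φ x).2 0 * (φ y).2 0, φ.injective ?_⟩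
      rw [map_smul, hww, hbr]
  · rintro ⟨h0, h1, w, hw, hne, hder⟩
    have hc : L.bracket w w ∈ L.grade 0 := L.bracket_mem hw hw
    have hw0 : w ≠ 0 := by
      rintro rfl
      simp at hne
    obtain ⟨γ, hγ, hγc⟩ := L.exists_functional_eq_one hc hne
    obtain ⟨δ, hδ, hδw⟩ := L.exists_functional_eq_one hw hw0
    have hx0 : ∀ x ∈ L.grade 0, x = γ x • L.bracket w w := fun x hx => by
      obtain ⟨t, ht⟩ := exists_smul_eq_of_finrank_eq_one h0
        (x := (⟨_, hc⟩ : L.grade 0)) (fun h => hne (congrArg Subtype.val h)) ⟨x, hx⟩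
      have ht' : t • L.bracket w w = x := congrArg Subtype.val ht
      rw [← ht', map_smul, hγc, smul_eq_mul, mul_one]
    have hx1 : ∀ x ∈ L.grade 1, x = δ x • w := fun x hx => by
      obtain ⟨t, ht⟩ := exists_smul_eq_of_finrank_eq_one h1
        (x := (⟨_, hw⟩ : L.grade 1)) (fun h => hw0 (congrArg Subtype.val h)) ⟨x, hx⟩
      have ht' : t • w = x := congrArg Subtype.val ht
      rw [← ht', map_smul, hδw, smul_eq_mul, mul_one]
    have hx : ∀ x, x = γ x • L.bracket w w + δ x • w := fun x => by
      induction x using L.homogeneous_induction with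
      | hom i x hx =>
        rcases zmod_two_cases i with rfl | rfl
        · rw [hδ _ _ hx zero_ne_one, zero_smul, add_zero]
          exact hx0 x hx
        · rw [hγ _ _ hx one_ne_zero, zero_smul, zero_add]
          exact hx1 x hx
      | add x y hx hy =>
        conv_lhs => rw [hx, hy]
        rw [map_add, map_add]
        module
    have hcw : L.bracket (L.bracket w w) w = 0 := by
      refine L.eq_zero_of_mem_grade zero_ne_one (L.bracket_mem hc hw) ?_
      exact (Submodule.span_singleton_le_iff_mem _ _).mpr hc
        (hder ▸ L.bracket_mem_derived (L.bracket w w) w)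
    have hbr : ∀ x y, L.bracket x y = (δ x * δ y) • L.bracket w w := fun x y => by
      conv_lhs => rw [hx x, hx y]
      simp only [map_add, map_smul, LinearMap.add_apply, LinearMap.smul_apply, hcw,
        bracket_self_eq_zero hc, L.bracket_eq_zero_comm hc hw hcw]
      module
    let φ : V →ₗ[F] ((Fin 0 → F) × (Fin 0 → F) × F) × (Fin 1 → F) :=
      ((0 : V →ₗ[F] (Fin 0 → F)).prod ((0 : V →ₗ[F] (Fin 0 → F)).prod γ)).prod
        (LinearMap.pi fun _ => δ)
    have hφ : ∀ x, φ x = ((0, 0, γ x), fun _ => δ x) := fun _ => rfl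
    refine ⟨⟨φ, fun {i x} hxi => ?_, fun x y => ?_⟩, ?_, ?_⟩
    · rw [hφ]
      rcases zmod_two_cases i with rfl | rfl
      · refine mem_prodGrade_zero.mpr (funext fun _ => ?_)
        exact hδ _ _ hxi zero_ne_one
      · refine mem_prodGrade_one.mpr ?_
        simp only [hγ _ _ hxi one_ne_zero]
        rfl
    · change φ _ = heisenbergBracket F 0 1 (φ x) (φ y)
      rw [heisenbergBracket_apply, hbr, map_smul, hφ, hφ, hφ, hγc, hδ _ _ hc zero_ne_one]
      refine Prod.ext (Prod.ext ?_ (Prod.ext ?_ ?_)) (funext fun _ => ?_) <;> simp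
    · refine (injective_iff_map_eq_zero φ).mpr fun x h => ?_
      rw [hφ] at h
      simp only [Prod.mk_eq_zero] at h
      rw [hx x, h.1.2.2, congrFun h.2 0]
      simp
    · rintro ⟨⟨a, b, g⟩, d⟩
      refine ⟨g • L.bracket w w + d 0 • w, ?_⟩
      rw [hφ]
      simp only [map_add, map_smul, hγc, hδw, hγ _ _ hw one_ne_zero, hδ _ _ hc zero_ne_one,
        smul_eq_mul, mul_one, mul_zero, add_zero, zero_add]
      refine Prod.ext (Prod.ext (Subsingleton.elim _ _) (Prod.ext (Subsingleton.elim _ _) rfl))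
        (funext fun i => ?_)
      rw [Subsingleton.elim i 0]

/-! ### Small rank forces an even central line -/

theorem one_le_finrank_of_mem [FiniteDimensional F V] {U : Submodule F V} {x : V} (hx : x ∈ U)
    (h0 : x ≠ 0) : 1 ≤ Module.finrank F U :=
  Submodule.one_le_finrank_iff.mpr fun h => h0 (by rwa [h, Submodule.mem_bot] at hx)

theorem le_span_of_finrank_eq_one {U : Submodule F V} (hU : Module.finrank F U = 1) {x : V}
    (hx : x ∈ U) (h0 : x ≠ 0) : U ≤ F ∙ x := fun y hy => by
  obtain ⟨t, ht⟩ := exists_smul_eq_of_finrank_eq_one hU (x := (⟨x, hx⟩ : U))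
    (fun h => h0 (congrArg Subtype.val h)) ⟨y, hy⟩
  exact Submodule.mem_span_singleton.mpr ⟨t, congrArg Subtype.val ht⟩

/-- A graded derived subalgebra is controlled by its homogeneous components. -/
theorem derived_le_of_components {L : LieSuperalgebra F V} {U : Submodule F V}
    (h : ∀ i, L.derived ⊓ L.grade i ≤ U) : L.derived ≤ U := fun x hx => by
  rw [← L.proj_add_proj x]
  exact add_mem (h 0 ⟨L.proj_mem_derived 0 hx, L.proj_mem 0 x⟩)
    (h 1 ⟨L.proj_mem_derived 1 hx, L.proj_mem 1 x⟩)

theorem derived_eq_span_of_finrank [FiniteDimensional F V] {L : LieSuperalgebra F V} {c : V}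
    (hc : c ∈ L.grade 0) (h0 : c ≠ 0) (hcd : c ∈ L.derived)
    (d0 : Module.finrank F ↥(L.derived ⊓ L.grade 0) = 1)
    (d1 : Module.finrank F ↥(L.derived ⊓ L.grade 1) = 0) : L.derived = F ∙ c := by
  refine le_antisymm (derived_le_of_components fun i => ?_)
    ((Submodule.span_singleton_le_iff_mem _ _).mpr hcd)
  rcases zmod_two_cases i with rfl | rfl
  · exact le_span_of_finrank_eq_one d0 ⟨hcd, hc⟩ h0
  · rw [Submodule.finrank_eq_zero.mp d1]
    exact bot_le

section

variable [CharZero F] [FiniteDimensional F V] {L : LieSuperalgebra F V}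

/-- The even part of the rank is positive: a homogeneous central commutator enlarges the even part
of `L.derived` when even, and yields an even non-cocycle when odd. -/
theorem smr_ne_zero_two (hnil : L.IsNilpotent) (hab : ¬ L.IsAbelian) : L.smr ≠ (0, 2) := by
  intro h
  obtain ⟨i, c, hc, h0, hcc, hcd⟩ := L.exists_central_derived hnil hab
  have : Nontrivial V := ⟨c, 0, h0⟩
  rw [smr_eq] at h
  obtain ⟨e0, -⟩ := Prod.mk.inj h
  have hle := Submodule.finrank_mono (L.cocycles_le_skewForms 0)
  rcases zmod_two_cases i with rfl | rfl
  · have := one_le_finrank_of_mem (U := L.derived ⊓ L.grade 0) ⟨hcd, hc⟩ h0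
    omega
  · have := finrank_cocycles_lt_of_odd hc h0 hcc hcd
    omega

/-- If the super-multiplier-rank is `(2, 0)` or `(1, 1)`, the derived subalgebra is an even central
line. -/
theorem exists_derived_eq_span (hnil : L.IsNilpotent) (hab : ¬ L.IsAbelian)
    (h : L.smr = (2, 0) ∨ L.smr = (1, 1)) :
    ∃ c ∈ L.grade 0, c ≠ 0 ∧ c ∈ L.center ∧ L.derived = F ∙ c := by
  obtain ⟨i, c, hc, h0, hcc, hcd⟩ := L.exists_central_derived hnil hab
  have : Nontrivial V := ⟨c, 0, h0⟩
  have hle0 := Submodule.finrank_mono (L.cocycles_le_skewForms 0)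
  have hle1 := Submodule.finrank_mono (L.cocycles_le_skewForms 1)
  have hodd : Module.finrank F ↥(L.derived ⊓ L.grade 1) ≠ 0 →
      ∃ d ∈ L.grade 1, d ≠ 0 ∧ d ∈ L.derived := fun hne => by
    obtain ⟨d, hd, hd0⟩ := Submodule.exists_mem_ne_zero_of_ne_bot
      fun e => hne (Submodule.finrank_eq_zero.mpr e)
    exact ⟨d, hd.2, hd0, hd.1⟩
  rw [smr_eq] at h
  rcases zmod_two_cases i with rfl | rfl
  · have hd := one_le_finrank_of_mem (U := L.derived ⊓ L.grade 0) ⟨hcd, hc⟩ h0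
    refine ⟨c, hc, h0, hcc, derived_eq_span_of_finrank hc h0 hcd ?_ ?_⟩
    · rcases h with h | h <;> obtain ⟨e0, e1⟩ := Prod.mk.inj h
      -- For rank `(2,0)`, an even part of `L.derived` of dimension other than 1 would have
      -- dimension 2 and leave no room for even non-cocycles; yet `c` and a commutator outside `F c`
      -- produce one.
      · by_contra hne
        have hk : Module.finrank F (L.cocycles 0) = Module.finrank F (L.skewForms 0) := by omega
        have hnot : ¬ L.derived ⊓ L.grade 0 ≤ F ∙ c := fun hs => by
          have := Submodule.finrank_mono hs
          rw [finrank_span_singleton h0] at this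
          omega
        obtain ⟨d, hd, hdc⟩ := SetLike.not_le_iff_exists.mp hnot
        have := finrank_cocycles_lt_of_even_even hc hcc hd.2 hd.1 h0 hdc
        omega
      · omega
    -- An odd `d ∈ L.derived` counts twice in the odd part of the rank: in `L.derived` itself, and
    -- through an odd non-cocycle pairing `c` with `d`.
    · by_contra hne
      obtain ⟨d, hd, hd0, hdd⟩ := hodd hne
      have := finrank_cocycles_lt_of_even_odd hc h0 hcc hd hd0 hdd
      rcases h with h | h <;> obtain ⟨e0, e1⟩ := Prod.mk.inj h <;> omega
  · exfalso
    have hd := one_le_finrank_of_mem (U := L.derived ⊓ L.grade 1) ⟨hcd, hc⟩ h0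
    have hk := finrank_cocycles_lt_of_odd hc h0 hcc hcd
    rcases h with h | h <;> obtain ⟨e0, e1⟩ := Prod.mk.inj h
    · omega
    -- For rank `(1,1)` the even non-cocycle from the odd `c` already uses up the even part, so
    -- `L.derived` is purely odd and equals `F c`; then there are two independent even failures, one
    -- too many.
    · have := finrank_cocycles_add_two_le hab hc hcc <| derived_le_of_components fun i => by
        rcases zmod_two_cases i with rfl | rfl
        · rw [Submodule.finrank_eq_zero.mp (show
            Module.finrank F ↥(L.derived ⊓ L.grade 0) = 0 by omega)]
          exact bot_le
        · exact le_span_of_finrank_eq_one (by omega) ⟨hcd, hc⟩ h0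
      omega

/-- The two possible shapes of a superalgebra of super-multiplier-rank `(2, 0)` or `(1, 1)`. -/
theorem structure_of_smr (hnil : L.IsNilpotent) (hab : ¬ L.IsAbelian)
    (h : L.smr = (2, 0) ∨ L.smr = (1, 1)) :
    (∃ w ∈ L.grade 1, L.bracket w w ≠ 0 ∧ L.derived = F ∙ L.bracket w w) ∨
      Nonempty (HeisenbergCoords L) := by
  obtain ⟨c, hc, h0, hcc, hder⟩ := exists_derived_eq_span hnil hab h
  by_cases hsq : ∀ w ∈ L.grade 1, L.bracket w w = 0
  · refine Or.inr (nonempty_heisenbergCoords hab hc hcc hder hsq ?_)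
    rcases h with h | h <;> rw [h]
    norm_num
  · push Not at hsq
    obtain ⟨w, hw, hne⟩ := hsq
    exact Or.inl ⟨w, hw, hne, derived_eq_span_of_mem hder (L.bracket_mem_derived w w) hne⟩

end

end LieSuperalgebra

open LieSuperalgebra

/-! ### The classification -/

theorem mainTheorem2 {F : Type u} [Field F] [IsAlgClosed F] [CharZero F]
    {V : Type v} [AddCommGroup V] [Module F V] [FiniteDimensional F V]
    (L : LieSuperalgebra F V) (hnil : L.IsNilpotent) (hab : ¬ L.IsAbelian) :
    L.smr ≠ (0, 2) ∧
    (L.smr = (2, 0) ↔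
      L.Isomorphic ((LieSuperalgebra.heisenberg F 1 0).directSum (LieSuperalgebra.ab F 1 0))) ∧
    (L.smr = (1, 1) ↔
      L.Isomorphic ((LieSuperalgebra.heisenberg F 1 0).directSum (LieSuperalgebra.ab F 0 1)) ∨
      L.Isomorphic (LieSuperalgebra.heisenberg F 0 1)) := by
  refine ⟨smr_ne_zero_two hnil hab, ⟨fun h => ?_, fun h => ?_⟩, fun h => ?_, fun h => ?_⟩
  · rcases structure_of_smr hnil hab (Or.inl h) with ⟨w, hw, hne, hder⟩ | ⟨⟨D⟩⟩
    -- The rank would be `sdim L`, whose odd part is nonzero because of `w`.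
    · rw [smr_eq_sdim_of_odd_square hw hne hder] at h
      have hw0 : w ≠ 0 := by
        rintro rfl
        simp at hne
      have := one_le_finrank_of_mem hw hw0
      obtain ⟨-, e1⟩ := Prod.mk.inj h
      omega
    · rw [D.smr_eq] at h
      obtain ⟨e0, e1⟩ := Prod.mk.inj h
      exact D.isomorphic (by omega) (by omega)
  · obtain ⟨D, e0, e1⟩ := h.exists_heisenbergCoords
    rw [D.smr_eq, e0, e1]
    rfl
  · rcases structure_of_smr hnil hab (Or.inr h) with ⟨w, hw, hne, hder⟩ | ⟨⟨D⟩⟩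
    · rw [smr_eq_sdim_of_odd_square hw hne hder] at h
      obtain ⟨e0, e1⟩ := Prod.mk.inj h
      exact Or.inr (isomorphic_heisenberg_zero_one_iff.mpr
        ⟨by omega, by omega, w, hw, hne, hder⟩)
    · rw [D.smr_eq] at h
      obtain ⟨e0, e1⟩ := Prod.mk.inj h
      -- `D.perp` has superdimension `(1,1)`, and `c` occupies the even dimension, leaving
      -- `Ab(0,1)`.
      exact Or.inl (D.isomorphic (by omega) (by omega))
  · rcases h with h | h
    · obtain ⟨D, e0, e1⟩ := h.exists_heisenbergCoords
      rw [D.smr_eq, e0, e1]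
      rfl
    · obtain ⟨e0, e1, w, hw, hne, hder⟩ := isomorphic_heisenberg_zero_one_iff.mp h
      rw [smr_eq_sdim_of_odd_square hw hne hder, e0, e1]
      rfl
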